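/- **Proposition.** Let $\mathcal C\rightrightarrows\mathcal X$ be a Lie category: a small category whose set of morphisms $\mathcal C$ is a smooth manifold with or without boundary and whose set of objects $\mathcal X$ is a smooth manifold without boundary, such that the source and target maps $s,t\colon\mathcal C\to\mathcal X$ are smooth submersions, the unit map $u\colon\mathcal X\to\mathcal C$, $x\mapsto 1_x$, and the composition $(g,h)\mapsto gh$ on $\{(g,h)\in\mathcal C\times\mathcal C : s(g)=t(h)\}$ are smooth, and the restrictions of $s$ and $t$ to $\partial\mathcal C$ are submersions. Assume that $\mathcal C$ has a normal boundary, that is, either $u(\mathcal X)\subset\operatorname{Int}\mathcal C$, or $\partial\mathcal C$ is a subcategory of $\mathcal C$ with $u(\mathcal X)\subset\partial\mathcal C$. Let $\alpha$ be a smooth section of the left Lie algebroid $A^L(\mathcal C)=u^*(\ker \mathrm dt)\to\mathcal X$. Let $\alpha^L$ be its left-invariant extension, the vector field on $\mathcal C$ given by $\alpha^L(g)=\mathrm d(L_g)_{1_{s(g)}}(\alpha_{s(g)})$, where $L_g\colon t^{-1}(s(g))\to t^{-1}(t(g))$, $L_g(h)=gh$, and let $\rho^L(\alpha)=\mathrm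 ds\circ\alpha$ be the vector field on $\mathcal X$ given by the anchor $\rho^L=\mathrm ds|_{A^L(\mathcal C)}$. Suppose that either $u(\mathcal X)\subset\operatorname{Int}\mathcal C$, or $u(\mathcal X)\subset\partial\mathcal C$ and $\alpha^L(1_x)\in T_{1_x}(\partial\mathcal C)$ for all $x\in\mathcal X$. Then $\alpha^L$ is complete if and only if $\rho^L(\alpha)$ is complete. (A vector field is complete if each of its maximal integral paths is defined on all of $\mathbb R$.) -/

import Mathlib

open Set
open scoped Manifold ContDiff

section Manifolds

variable {E H : Type*} [NormedAddCommGroup E] [NormedSpace ℝ E] [TopologicalSpace H]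

/-- The model with corners `I` is a model for manifolds with or without boundary (no corners): its
range is a closed half-space `{v | 0 ≤ φ v}`. The functional `φ = 0` is allowed; it gives the
whole space, that is, a model for manifolds without boundary. -/
def IsHalfSpaceModel (I : ModelWithCorners ℝ E H) : Prop :=
  ∃ φ : E →L[ℝ] ℝ, range I = {v | 0 ≤ φ v}

variable (I : ModelWithCorners ℝ E H) {M : Type*} [TopologicalSpace M] [ChartedSpace H M]

/-- The tangent space `T_g(∂M) ⊆ T_g M` at a boundary point `g` of a manifold with boundary. In the
preferred chart at `g`, through which Mathlib identifies `T_g M` with the model space `E`, the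
boundary is the hyperplane bounding the model half-space `range I`, and `T_g(∂M)` is the direction
of that hyperplane. -/
def boundaryTangentSpace (g : M) : Submodule ℝ (TangentSpace I g) :=
  (vectorSpan ℝ (frontier (range I)) : Submodule ℝ E)

/-- A vector field `X` on `M` is complete if every point of `M` is the starting point of an integral
path of `X` that is defined on the whole real line. -/
def IsCompleteVectorField (X : (p : M) → TangentSpace I p) : Prop :=
  ∀ p : M, ∃ γ : ℝ → M, γ 0 = p ∧ IsMIntegralCurve (I := I) γ X

end Manifolds

section LieCategories

variable {E H F K : Type*} [NormedAddCommGroup E] [NormedSpace ℝ E] [TopologicalSpace H]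
  [NormedAddCommGroup F] [NormedSpace ℝ F] [TopologicalSpace K]

/-- A Lie category `C ⇉ X` on the manifold of morphisms `C` (with or without boundary) and the
manifold of objects `X` (without boundary). The function `comp` is composition, `comp g h = gh`; it
is only meaningful on the composable pairs `s g = t h`, and no condition refers to its values
elsewhere. The composable pairs form an embedded submanifold of `C × C` (with corners), and
smoothness of the composition on it is stated as smoothness on this subset of `C × C`. -/
structure LieCategory (I : ModelWithCorners ℝ E H) (J : ModelWithCorners ℝ F K)
    (C : Type*) [TopologicalSpace C] [ChartedSpace H C]
    (X : Type*) [TopologicalSpace X] [ChartedSpace K X] where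
  /-- source map -/
  s : C → X
  /-- target map -/
  t : C → X
  /-- unit map -/
  u : X → C
  /-- composition -/
  comp : C → C → C
  s_unit : ∀ x, s (u x) = x
  t_unit : ∀ x, t (u x) = x
  s_comp : ∀ g h, s g = t h → s (comp g h) = s h
  t_comp : ∀ g h, s g = t h → t (comp g h) = t g
  comp_unit : ∀ g, comp g (u (s g)) = g
  unit_comp : ∀ g, comp (u (t g)) g = g
  comp_assoc : ∀ g h k, s g = t h → s h = t k → comp (comp g h) k = comp g (comp h k)
  smooth_s : ContMDiff I J ∞ s
  smooth_t : ContMDiff I J ∞ t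
  smooth_u : ContMDiff J I ∞ u
  smooth_comp : ContMDiffOn (I.prod I) I ∞ (fun p : C × C => comp p.1 p.2) {p | s p.1 = t p.2}
  /-- `s` is a submersion -/
  submersion_s : ∀ g, Function.Surjective (mfderiv I J s g)
  /-- `t` is a submersion -/
  submersion_t : ∀ g, Function.Surjective (mfderiv I J t g)
  /-- regular boundary: the restriction of `s` to `∂C` is a submersion -/
  submersion_boundary_s : ∀ g ∈ I.boundary C,
    SurjOn (mfderiv I J s g) (boundaryTangentSpace I g) univ
  /-- regular boundary: the restriction of `t` to `∂C` is a submersion -/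
  submersion_boundary_t : ∀ g ∈ I.boundary C,
    SurjOn (mfderiv I J t g) (boundaryTangentSpace I g) univ

variable {I : ModelWithCorners ℝ E H} {J : ModelWithCorners ℝ F K}
  {C : Type*} [TopologicalSpace C] [ChartedSpace H C]
  {X : Type*} [TopologicalSpace X] [ChartedSpace K X]

namespace LieCategory

/-- Normal boundary: either all units lie in the interior of `C`, or `∂C` is a wide subcategory. -/
def HasNormalBoundary (𝒞 : LieCategory I J C X) : Prop :=
  range 𝒞.u ⊆ I.interior C ∨
    (range 𝒞.u ⊆ I.boundary C ∧
      ∀ g ∈ I.boundary C, ∀ h ∈ I.boundary C, 𝒞.s g = 𝒞.t h → 𝒞.comp g h ∈ I.boundary C)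

/-- A smooth section `α` of the left Lie algebroid `A^L(C) = u^*(ker dt)`: it assigns to `x` a
vector in `T_{u x} C` that is tangent to the `t`-fibre, and is smooth as a map into `TC`. -/
structure LeftAlgebroidSection (𝒞 : LieCategory I J C X) [IsManifold I ∞ C] where
  /-- the underlying family of tangent vectors at the units -/
  toFun : ∀ x : X, TangentSpace I (𝒞.u x)
  mem_ker : ∀ x, mfderiv I J 𝒞.t (𝒞.u x) (toFun x) = 0
  smooth : ContMDiff J I.tangent ∞ (fun x => (⟨𝒞.u x, toFun x⟩ : TangentBundle I C))

variable [IsManifold I ∞ C] {𝒞 : LieCategory I J C X}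

namespace LeftAlgebroidSection

/-- The left-invariant extension `α^L(g) = d(L_g)_{1_{s(g)}} (α_{s(g)})`, where `L_g h = gh` is the
left translation, defined on the `t`-fibre over `s(g)`; hence the derivative within that fibre.
(The derivative takes values in the tangent space at `g 1_{s(g)}`, which is the point `g`.) -/
noncomputable def leftExtension (α : 𝒞.LeftAlgebroidSection) (g : C) : TangentSpace I g :=
  (mfderivWithin I I (𝒞.comp g) (𝒞.t ⁻¹' {𝒞.s g}) (𝒞.u (𝒞.s g)) (α.toFun (𝒞.s g)) : E)

/-- The vector field `ρ^L(α)` on the base, where `ρ^L = ds` is the anchor. (The derivative takes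
values in the tangent space at `s(1_x)`, which is the point `x`.) -/
noncomputable def anchor (α : 𝒞.LeftAlgebroidSection) (x : X) : TangentSpace J x :=
  (mfderiv I J 𝒞.s (𝒞.u x) (α.toFun x) : F)

end LeftAlgebroidSection

end LieCategory

end LieCategories

/-! The derivative of `L_g` within a `t`-fibre is determined only on the tangent cone of that fibre,
so everything rests on representing `α x` by a two-sided curve `σ` through `1_x` inside `t⁻¹(x)`
(`IsFibreCurve`). Then `α^L(g)` is the velocity of `gσ` at `0`, and the category axioms give three
facts: `α^L` is left-invariant, since `g(hσ) = (gh)σ`; it is `s`-related to `ρ^L(α)`, since `s(gσ) =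
s(σ)`; it is killed by `dt`, since `t(gσ) = t(g)`.

If `α^L` is complete, `s` maps its integral path through `1_x` to an integral path of `ρ^L(α)`
through `x`. Conversely, let `c` be a global integral path of `ρ^L(α)` through `s(g)`. Near each
unit `α^L` has integral paths on a uniform time interval (`exists_flow`). Such a path `γ` from
`1_{c(a)}` stays in one `t`-fibre and lies over `c`, by uniqueness of integral paths on the base.
Hence `kγ` is an integral path from any `k` over `c(a)`. The available time depends on `c(a)` only,
so lifts of `c` continue across every compact interval and glue to a global path. Uniqueness on `C`
is never needed.

Fibre curves and local integral paths are built in a subcategory `S` that is a linear slice `W` of a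
chart near the unit (`IsUnitSlice`): `S = C` for interior units, `S = ∂C` for boundary units. In the
second case `α` itself must be tangent to `∂C`, whereas the hypothesis concerns `α^L(1_x)`, a
derivative of the identity of the fibre. A vector of `ker dt` transverse to `∂C` lies, up to sign,
in the tangent cone of the fibre, where this derivative is forced to be the identity; so tangency
passes from `α^L(1_x)` to `α x`. -/

open scoped Topology

/-! ### Velocities of curves and the chain rule. -/

section Velocity

variable {E H F K : Type*} [NormedAddCommGroup E] [NormedSpace ℝ E] [TopologicalSpace H]
  [NormedAddCommGroup F] [NormedSpace ℝ F] [TopologicalSpace K]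
  (I : ModelWithCorners ℝ E H) {J : ModelWithCorners ℝ F K}
  {M : Type*} [TopologicalSpace M] [ChartedSpace H M]
  {N : Type*} [TopologicalSpace N] [ChartedSpace K N]

/-- The curve `γ` has velocity `v` at time `τ` within the set `S` of times. The tangent space at
`γ τ` is identified with the model space. -/
def HasVelocityWithinAt (γ : ℝ → M) (v : E) (S : Set ℝ) (τ : ℝ) : Prop :=
  HasMFDerivWithinAt 𝓘(ℝ, ℝ) I γ S τ ((1 : ℝ →L[ℝ] ℝ).smulRight v : ℝ →L[ℝ] E)

/-- The curve `γ` has velocity `v` at time `τ`. -/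
def HasVelocityAt (γ : ℝ → M) (v : E) (τ : ℝ) : Prop :=
  HasMFDerivAt 𝓘(ℝ, ℝ) I γ τ ((1 : ℝ →L[ℝ] ℝ).smulRight v : ℝ →L[ℝ] E)

variable {I} {γ γ' : ℝ → M} {v w : E} {S S' : Set ℝ} {τ : ℝ}

lemma isMIntegralCurveOn_iff_hasVelocityWithinAt {V : (p : M) → TangentSpace I p} :
    IsMIntegralCurveOn γ V S ↔ ∀ τ ∈ S, HasVelocityWithinAt I γ (V (γ τ)) S τ := Iff.rfl

lemma hasVelocityWithinAt_univ : HasVelocityWithinAt I γ v univ τ ↔ HasVelocityAt I γ v τ :=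
  hasMFDerivWithinAt_univ

lemma HasVelocityAt.hasVelocityWithinAt (h : HasVelocityAt I γ v τ) :
    HasVelocityWithinAt I γ v S τ := HasMFDerivAt.hasMFDerivWithinAt h

lemma HasVelocityWithinAt.hasVelocityAt (h : HasVelocityWithinAt I γ v S τ) (hS : S ∈ 𝓝 τ) :
    HasVelocityAt I γ v τ := HasMFDerivWithinAt.hasMFDerivAt h hS

lemma HasVelocityWithinAt.mono (h : HasVelocityWithinAt I γ v S τ) (hS : S' ⊆ S) :
    HasVelocityWithinAt I γ v S' τ := HasMFDerivWithinAt.mono h hS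

lemma HasVelocityAt.continuousAt (h : HasVelocityAt I γ v τ) : ContinuousAt γ τ :=
  HasMFDerivAt.continuousAt h

lemma HasVelocityAt.unique (h : HasVelocityAt I γ v τ) (h' : HasVelocityAt I γ w τ) : v = w := by
  have := DFunLike.congr_fun (hasMFDerivAt_unique h h') (1 : ℝ)
  have e (v : E) : ((1 : ℝ →L[ℝ] ℝ).smulRight v : ℝ →L[ℝ] E) 1 = v := by simp
  rw [← e v, ← e w]
  exact this

lemma HasVelocityWithinAt.congr_of_eventuallyEq (h : HasVelocityWithinAt I γ v S τ)
    (he : γ' =ᶠ[𝓝[S] τ] γ) (hτ : γ' τ = γ τ) : HasVelocityWithinAt I γ' v S τ :=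
  HasMFDerivWithinAt.congr_of_eventuallyEq h he hτ

lemma HasVelocityAt.congr_of_eventuallyEq (h : HasVelocityAt I γ v τ)
    (he : γ' =ᶠ[𝓝 τ] γ) : HasVelocityAt I γ' v τ :=
  HasMFDerivAt.congr_of_eventuallyEq h he

lemma HasVelocityWithinAt.map {f : M → N} {A : E →L[ℝ] F} {T : Set M}
    (hf : HasMFDerivWithinAt I J f T (γ τ) A)
    (h : HasVelocityWithinAt I γ v S τ) (hT : ∀ θ ∈ S, γ θ ∈ T) :
    HasVelocityWithinAt J (f ∘ γ) (A v) S τ := by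
  have e : A.comp ((1 : ℝ →L[ℝ] ℝ).smulRight v) = (1 : ℝ →L[ℝ] ℝ).smulRight (A v) := by
    ext; simp
  exact HasMFDerivWithinAt.congr_mfderiv (HasMFDerivWithinAt.comp τ hf h hT) e

lemma HasVelocityAt.map {f : M → N} {A : E →L[ℝ] F}
    (hf : HasMFDerivAt I J f (γ τ) A) (h : HasVelocityAt I γ v τ) :
    HasVelocityAt J (f ∘ γ) (A v) τ :=
  hasVelocityWithinAt_univ.1 <|
    HasVelocityWithinAt.map (hf.hasMFDerivWithinAt (s := univ)) (hasVelocityWithinAt_univ.2 h)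
      fun _ _ ↦ mem_univ _

lemma HasVelocityWithinAt.map_mfderiv {f : M → N} (hf : MDifferentiableAt I J f (γ τ))
    (h : HasVelocityWithinAt I γ v S τ) :
    HasVelocityWithinAt J (f ∘ γ) ((mfderiv I J f (γ τ) : E →L[ℝ] F) v) S τ :=
  h.map (E := E) (F := F) (T := univ) hf.hasMFDerivAt.hasMFDerivWithinAt fun _ _ ↦ mem_univ _

lemma HasVelocityAt.map_mfderiv {f : M → N} (hf : MDifferentiableAt I J f (γ τ))
    (h : HasVelocityAt I γ v τ) :
    HasVelocityAt J (f ∘ γ) ((mfderiv I J f (γ τ) : E →L[ℝ] F) v) τ :=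
  h.map (E := E) (F := F) hf.hasMFDerivAt

/-- A velocity at a time at which the curve stays in `T` is mapped by a derivative within `T`. -/
lemma HasVelocityAt.map_within {f : M → N} {A : E →L[ℝ] F} {T : Set M}
    (hf : HasMFDerivWithinAt I J f T (γ τ) A)
    (h : HasVelocityAt I γ v τ) (hT : ∀ᶠ θ in 𝓝 τ, γ θ ∈ T) :
    HasVelocityAt J (f ∘ γ) (A v) τ :=
  ((h.hasVelocityWithinAt (S := {θ | γ θ ∈ T})).map hf fun _ h ↦ h).hasVelocityAt hT

lemma hasVelocityAt_const (p : M) : HasVelocityAt I (fun _ ↦ p) (0 : E) τ := by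
  have e : (0 : ℝ →L[ℝ] E) = (1 : ℝ →L[ℝ] ℝ).smulRight (0 : E) := by
    ext; simp
  exact HasMFDerivAt.congr_mfderiv (hasMFDerivAt_const p τ) e

lemma hasVelocityWithinAt_iff_hasDerivWithinAt {c : ℝ → E} :
    HasVelocityWithinAt 𝓘(ℝ, E) c v S τ ↔ HasDerivWithinAt c v S τ :=
  hasMFDerivWithinAt_iff_hasFDerivWithinAt.trans (by
    have e : (1 : ℝ →L[ℝ] ℝ).smulRight v = ContinuousLinearMap.toSpanSingleton ℝ v := by
      ext; simp
    rw [hasDerivWithinAt_iff_hasFDerivWithinAt, ← e]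
    rfl)

lemma hasVelocityAt_iff_hasDerivAt {c : ℝ → E} :
    HasVelocityAt 𝓘(ℝ, E) c v τ ↔ HasDerivAt c v τ := by
  rw [← hasVelocityWithinAt_univ, hasVelocityWithinAt_iff_hasDerivWithinAt, hasDerivWithinAt_univ]

/-- Translation in time. -/
lemma HasVelocityAt.comp_sub {a : ℝ} (h : HasVelocityAt I γ v (τ - a)) :
    HasVelocityAt I (fun θ ↦ γ (θ - a)) v τ := by
  have h1 : HasVelocityAt 𝓘(ℝ, ℝ) (fun θ : ℝ ↦ θ - a) (1 : ℝ) τ :=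
    hasVelocityAt_iff_hasDerivAt.2 ((hasDerivAt_id τ).sub_const a)
  have h2 := HasVelocityAt.map (E := ℝ) (F := E) (f := γ) (γ := fun θ : ℝ ↦ θ - a) h h1
  have e : ((1 : ℝ →L[ℝ] ℝ).smulRight v) 1 = v := by simp
  rw [e] at h2
  exact h2

end Velocity

/-! ### Left invariance of the extension, and its images under `s` and `t`. -/

section LieCategories

variable {E H F K : Type*} [NormedAddCommGroup E] [NormedSpace ℝ E] [TopologicalSpace H]
  [NormedAddCommGroup F] [NormedSpace ℝ F] [TopologicalSpace K]
  {I : ModelWithCorners ℝ E H} {J : ModelWithCorners ℝ F K}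
  {C : Type*} [TopologicalSpace C] [ChartedSpace H C]
  {X : Type*} [TopologicalSpace X] [ChartedSpace K X]

namespace LieCategory

lemma mdifferentiableWithinAt_comp (𝒞 : LieCategory I J C X) {g h : C} (hgh : 𝒞.s g = 𝒞.t h) :
    MDifferentiableWithinAt I I (𝒞.comp g) (𝒞.t ⁻¹' {𝒞.s g}) h := by
  have h1 : ContMDiffWithinAt I I ∞ (𝒞.comp g) (𝒞.t ⁻¹' {𝒞.s g}) h := by
    have := 𝒞.smooth_comp (g, h) hgh
    exact this.comp (f := fun k ↦ (g, k)) h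
      (contMDiffWithinAt_const.prodMk contMDiffWithinAt_id) (fun k hk ↦ hk.symm)
  exact h1.mdifferentiableWithinAt (by simp)

/-- The derivative of the left translation by `g` along the `t`-fibre. -/
noncomputable def leftDeriv (𝒞 : LieCategory I J C X) (g h : C) : E →L[ℝ] E :=
  mfderivWithin I I (𝒞.comp g) (𝒞.t ⁻¹' {𝒞.s g}) h

lemma hasMFDerivWithinAt_comp (𝒞 : LieCategory I J C X) {g h : C} (hgh : 𝒞.s g = 𝒞.t h) :
    HasMFDerivWithinAt I I (𝒞.comp g) (𝒞.t ⁻¹' {𝒞.s g}) h (𝒞.leftDeriv g h) :=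
  (𝒞.mdifferentiableWithinAt_comp hgh).hasMFDerivWithinAt

lemma mdifferentiable_s (𝒞 : LieCategory I J C X) : MDifferentiable I J 𝒞.s :=
  𝒞.smooth_s.mdifferentiable (by simp)

lemma mdifferentiable_t (𝒞 : LieCategory I J C X) : MDifferentiable I J 𝒞.t :=
  𝒞.smooth_t.mdifferentiable (by simp)

variable [IsManifold I ∞ C] {𝒞 : LieCategory I J C X}

namespace LeftAlgebroidSection

variable (α : 𝒞.LeftAlgebroidSection)

/-- The curve `σ` represents the value of the section `α` at `x` by a curve in the `t`-fibre. -/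
structure IsFibreCurve (x : X) (σ : ℝ → C) : Prop where
  zero : σ 0 = 𝒞.u x
  fibre : ∀ᶠ τ in 𝓝 0, 𝒞.t (σ τ) = x
  velocity : HasVelocityAt I σ (α.toFun x : E) 0

lemma leftExtension_eq (g : C) :
    (α.leftExtension g : E) = 𝒞.leftDeriv g (𝒞.u (𝒞.s g)) (α.toFun (𝒞.s g) : E) := rfl

variable {α}

/-- The chain rule applies to any derivative within the fibre, so the velocity of `gσ` identifies
`α^L(g)` whichever derivative `mfderivWithin` selects. -/
lemma IsFibreCurve.hasVelocityAt_comp {g : C} {σ : ℝ → C} (h : α.IsFibreCurve (𝒞.s g) σ) :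
    HasVelocityAt I (fun τ ↦ 𝒞.comp g (σ τ)) (α.leftExtension g : E) 0 := by
  rw [leftExtension_eq]
  refine HasVelocityAt.map_within (T := 𝒞.t ⁻¹' {𝒞.s g}) (f := 𝒞.comp g) ?_ h.velocity h.fibre
  rw [h.zero]
  exact 𝒞.hasMFDerivWithinAt_comp (𝒞.t_unit _).symm

variable (hα : ∀ x, ∃ σ, α.IsFibreCurve x σ)
include hα

/-- Left invariance: associativity makes `g(hσ)` and `(gh)σ` the same curve, and both sides are its
velocity. -/
lemma leftExtension_comp {g h : C} (hgh : 𝒞.s g = 𝒞.t h) :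
    (α.leftExtension (𝒞.comp g h) : E) = 𝒞.leftDeriv g h (α.leftExtension h : E) := by
  obtain ⟨σ, hσ⟩ := hα (𝒞.s h)
  have h1 := hσ.hasVelocityAt_comp
  have h0 : 𝒞.comp h (σ 0) = h := by rw [hσ.zero, 𝒞.comp_unit]
  have h2 : HasVelocityAt I (𝒞.comp g ∘ fun τ ↦ 𝒞.comp h (σ τ))
      (𝒞.leftDeriv g h (α.leftExtension h : E)) 0 := by
    refine HasVelocityAt.map_within (T := 𝒞.t ⁻¹' {𝒞.s g}) ?_ h1 ?_
    · rw [h0]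
      exact 𝒞.hasMFDerivWithinAt_comp hgh
    · filter_upwards [hσ.fibre] with τ hτ
      rw [mem_preimage, mem_singleton_iff, 𝒞.t_comp _ _ hτ.symm, hgh]
  have h3 : HasVelocityAt I (fun τ ↦ 𝒞.comp (𝒞.comp g h) (σ τ))
      (α.leftExtension (𝒞.comp g h) : E) 0 := by
    refine IsFibreCurve.hasVelocityAt_comp ?_
    rwa [𝒞.s_comp _ _ hgh]
  refine h3.unique (h2.congr_of_eventuallyEq ?_)
  filter_upwards [hσ.fibre] with τ hτ
  exact 𝒞.comp_assoc _ _ _ hgh hτ.symm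

lemma mfderiv_s_leftExtension (g : C) :
    (mfderiv I J 𝒞.s g : E →L[ℝ] F) (α.leftExtension g : E) = (α.anchor (𝒞.s g) : F) := by
  obtain ⟨σ, hσ⟩ := hα (𝒞.s g)
  have h0 : 𝒞.comp g (σ 0) = g := by rw [hσ.zero, 𝒞.comp_unit]
  have h1 := hσ.hasVelocityAt_comp.map_mfderiv (𝒞.mdifferentiable_s _)
  have h2 := hσ.velocity.map_mfderiv (𝒞.mdifferentiable_s _)
  rw [h0] at h1
  rw [hσ.zero] at h2
  refine h1.unique (h2.congr_of_eventuallyEq ?_)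
  filter_upwards [hσ.fibre] with τ hτ
  exact 𝒞.s_comp _ _ hτ.symm

lemma mfderiv_t_leftExtension (g : C) :
    (mfderiv I J 𝒞.t g : E →L[ℝ] F) (α.leftExtension g : E) = 0 := by
  obtain ⟨σ, hσ⟩ := hα (𝒞.s g)
  have h0 : 𝒞.comp g (σ 0) = g := by rw [hσ.zero, 𝒞.comp_unit]
  have h1 := hσ.hasVelocityAt_comp.map_mfderiv (𝒞.mdifferentiable_t _)
  rw [h0] at h1
  refine h1.unique ((hasVelocityAt_const (𝒞.t g)).congr_of_eventuallyEq ?_)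
  filter_upwards [hσ.fibre] with τ hτ
  exact 𝒞.t_comp _ _ hτ.symm

variable {γ : ℝ → C} {S : Set ℝ} (hγ : IsMIntegralCurveOn γ α.leftExtension S)
include hγ

lemma isMIntegralCurveOn_s_comp : IsMIntegralCurveOn (𝒞.s ∘ γ) α.anchor S := by
  rw [isMIntegralCurveOn_iff_hasVelocityWithinAt] at hγ ⊢
  intro τ hτ
  have := (hγ τ hτ).map_mfderiv (𝒞.mdifferentiable_s _)
  rwa [mfderiv_s_leftExtension hα] at this

lemma isMIntegralCurveOn_t_comp :
    IsMIntegralCurveOn (I := J) (𝒞.t ∘ γ) (fun x ↦ (0 : TangentSpace J x)) S := by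
  rw [isMIntegralCurveOn_iff_hasVelocityWithinAt] at hγ ⊢
  intro τ hτ
  have := (hγ τ hτ).map_mfderiv (𝒞.mdifferentiable_t _)
  rwa [mfderiv_t_leftExtension hα] at this

lemma isMIntegralCurveOn_comp {g : C} (hg : ∀ τ ∈ S, 𝒞.t (γ τ) = 𝒞.s g) :
    IsMIntegralCurveOn (fun τ ↦ 𝒞.comp g (γ τ)) α.leftExtension S := by
  rw [isMIntegralCurveOn_iff_hasVelocityWithinAt] at hγ ⊢
  intro τ hτ
  rw [leftExtension_comp hα (hg τ hτ).symm]
  exact (hγ τ hτ).map (𝒞.hasMFDerivWithinAt_comp (hg τ hτ).symm) hg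

end LeftAlgebroidSection

end LieCategory

end LieCategories

/-! ### Continuation and gluing of integral paths over a base curve. -/

section Gluing

variable {E H : Type*} [NormedAddCommGroup E] [NormedSpace ℝ E] [TopologicalSpace H]
  {I : ModelWithCorners ℝ E H} {M : Type*} [TopologicalSpace M] [ChartedSpace H M]
  {V : (p : M) → TangentSpace I p}

/-- Integral paths that meet at time `b` can be concatenated. -/
lemma IsMIntegralCurveOn.concat {γ₁ γ₂ : ℝ → M} {S₁ S₂ : Set ℝ} {b : ℝ}
    (h₁ : IsMIntegralCurveOn γ₁ V S₁) (h₂ : IsMIntegralCurveOn γ₂ V S₂)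
    (hS₁ : S₁ ⊆ Iic b) (hS₂ : S₂ ⊆ Ici b) (hb₁ : b ∈ S₁) (hb₂ : b ∈ S₂) (hb : γ₁ b = γ₂ b) :
    ∃ γ : ℝ → M, EqOn γ γ₁ S₁ ∧ EqOn γ γ₂ S₂ ∧ IsMIntegralCurveOn γ V (S₁ ∪ S₂) := by
  classical
  have e₁ : EqOn (fun τ ↦ if τ ≤ b then γ₁ τ else γ₂ τ) γ₁ S₁ := fun τ hτ ↦ if_pos (hS₁ hτ)
  have e₂ : EqOn (fun τ ↦ if τ ≤ b then γ₁ τ else γ₂ τ) γ₂ S₂ := fun τ hτ ↦ by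
    rcases (mem_Ici.1 (hS₂ hτ)).eq_or_lt with rfl | h
    · simpa using hb
    · exact if_neg (not_le.2 h)
  refine ⟨_, e₁, e₂, ?_⟩
  generalize (fun τ ↦ if τ ≤ b then γ₁ τ else γ₂ τ) = γ at e₁ e₂
  have k₁ (τ) (hτ : τ ∈ S₁) : HasVelocityWithinAt I γ (V (γ τ)) S₁ τ := by
    rw [e₁ hτ]
    exact HasVelocityWithinAt.congr_of_eventuallyEq (h₁ τ hτ)
      (Filter.eventually_of_mem self_mem_nhdsWithin e₁) (e₁ hτ)
  have k₂ (τ) (hτ : τ ∈ S₂) : HasVelocityWithinAt I γ (V (γ τ)) S₂ τ := by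
    rw [e₂ hτ]
    exact HasVelocityWithinAt.congr_of_eventuallyEq (h₂ τ hτ)
      (Filter.eventually_of_mem self_mem_nhdsWithin e₂) (e₂ hτ)
  rw [isMIntegralCurveOn_iff_hasVelocityWithinAt]
  intro τ hτ
  rcases lt_trichotomy τ b with h | rfl | h
  · refine (hasMFDerivWithinAt_inter (Iio_mem_nhds h)).1 ((k₁ τ ?_).mono ?_)
    · exact hτ.resolve_right fun h' ↦ absurd (mem_Ici.1 (hS₂ h')) (not_le.2 h)
    · exact fun θ hθ ↦ hθ.1.resolve_right fun h' ↦ absurd (mem_Ici.1 (hS₂ h')) (not_le.2 (by simpa using hθ.2))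
  -- At the junction both one-sided velocities equal the field at the same point.
  · exact HasMFDerivWithinAt.union (k₁ τ hb₁) (k₂ τ hb₂)
  · refine (hasMFDerivWithinAt_inter (Ioi_mem_nhds h)).1 ((k₂ τ ?_).mono ?_)
    · exact hτ.resolve_left fun h' ↦ absurd (mem_Iic.1 (hS₁ h')) (not_le.2 h)
    · exact fun θ hθ ↦ hθ.1.resolve_left fun h' ↦ absurd (mem_Iic.1 (hS₁ h')) (not_le.2 (by simpa using hθ.2))

variable {Y : Type*} (V) (s : M → Y) (c : ℝ → Y)

/-- The curve `γ` is an integral path of `V` on `S` that lifts the curve `c` along `s`. -/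
def IsIntegralLift (γ : ℝ → M) (S : Set ℝ) : Prop :=
  IsMIntegralCurveOn γ V S ∧ ∀ τ ∈ S, s (γ τ) = c τ

/-- Integral paths of `V` that lift `c` can be continued from time `a` to time `b`. -/
def HasIntegralLifts (a b : ℝ) : Prop :=
  ∀ g, s g = c a → ∃ γ : ℝ → M, γ a = g ∧ IsIntegralLift V s c γ (uIcc a b)

variable {V s c}

lemma IsIntegralLift.concat {γ₁ γ₂ : ℝ → M} {S₁ S₂ : Set ℝ} {b : ℝ}
    (h₁ : IsIntegralLift V s c γ₁ S₁) (h₂ : IsIntegralLift V s c γ₂ S₂)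
    (hS₁ : S₁ ⊆ Iic b) (hS₂ : S₂ ⊆ Ici b) (hb₁ : b ∈ S₁) (hb₂ : b ∈ S₂) (hb : γ₁ b = γ₂ b) :
    ∃ γ : ℝ → M, EqOn γ γ₁ S₁ ∧ EqOn γ γ₂ S₂ ∧ IsIntegralLift V s c γ (S₁ ∪ S₂) := by
  obtain ⟨γ, e₁, e₂, h⟩ := h₁.1.concat h₂.1 hS₁ hS₂ hb₁ hb₂ hb
  refine ⟨γ, e₁, e₂, h, ?_⟩
  rintro τ (hτ | hτ)
  · rw [e₁ hτ, h₁.2 τ hτ]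
  · rw [e₂ hτ, h₂.2 τ hτ]

lemma HasIntegralLifts.trans {a b d : ℝ} (h₁ : HasIntegralLifts V s c a b) (h₂ : HasIntegralLifts V s c b d)
    (hb : b ∈ uIcc a d) : HasIntegralLifts V s c a d := by
  intro g hg
  obtain ⟨γ₁, hγ₁, l₁⟩ := h₁ g hg
  obtain ⟨γ₂, hγ₂, l₂⟩ := h₂ (γ₁ b) (l₁.2 b right_mem_uIcc)
  rcases le_total a d with had | had
  · rw [uIcc_of_le had] at hb ⊢
    rw [uIcc_of_le hb.1] at l₁
    rw [uIcc_of_le hb.2] at l₂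
    obtain ⟨γ, e₁, -, l⟩ := l₁.concat l₂ (fun _ h ↦ h.2) (fun _ h ↦ h.1)
      (right_mem_Icc.2 hb.1) (left_mem_Icc.2 hb.2) hγ₂.symm
    rw [Icc_union_Icc_eq_Icc hb.1 hb.2] at l
    exact ⟨γ, by rw [e₁ (left_mem_Icc.2 hb.1), hγ₁], l⟩
  · rw [uIcc_of_ge had] at hb ⊢
    rw [uIcc_of_ge hb.2] at l₁
    rw [uIcc_of_ge hb.1] at l₂
    obtain ⟨γ, -, e₁, l⟩ := l₂.concat l₁ (fun _ h ↦ h.2) (fun _ h ↦ h.1)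
      (right_mem_Icc.2 hb.1) (left_mem_Icc.2 hb.2) hγ₂
    rw [Icc_union_Icc_eq_Icc hb.1 hb.2] at l
    exact ⟨γ, by rw [e₁ (right_mem_Icc.2 hb.2), hγ₁], l⟩

/-- Compactness: a Lebesgue number `δ` of the cover by the sets `U τ` allows passing from `a` to `b`
in `n` steps shorter than `δ`, each inside a single `U τ`. The steps may run backwards in time. -/
lemma hasIntegralLifts_of_forall_exists
    (h : ∀ τ, ∃ U ∈ 𝓝 τ, ∀ a ∈ U, ∀ b ∈ U, HasIntegralLifts V s c a b) (a b : ℝ) :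
    HasIntegralLifts V s c a b := by
  choose U hU hlift using h
  obtain ⟨δ, hδ, hball⟩ := lebesgue_number_lemma_of_metric (isCompact_uIcc (a := a) (b := b))
    (fun τ ↦ isOpen_interior (s := U τ)) fun τ _ ↦ mem_iUnion.2 ⟨τ, mem_interior_iff_mem_nhds.2 (hU τ)⟩
  have key (x) (hx : x ∈ uIcc a b) (y) (hxy : |y - x| < δ) : HasIntegralLifts V s c x y := by
    obtain ⟨τ, hτ⟩ := hball x hx
    exact hlift τ _ (interior_subset (hτ (Metric.mem_ball_self hδ))) _
      (interior_subset (hτ (by simpa [Real.dist_eq] using hxy)))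
  obtain ⟨n, hn⟩ := exists_nat_gt (|b - a| / δ)
  have hn0 : (0 : ℝ) < n := (div_nonneg (abs_nonneg _) hδ.le).trans_lt hn
  have hmem (k : ℝ) (hk0 : 0 ≤ k) (hk : k ≤ n) : a + k / n * (b - a) ∈ uIcc a b := by
    have h1 : k / n ≤ 1 := (div_le_one hn0).2 hk
    have h0 : 0 ≤ k / n := by positivity
    rw [mem_uIcc]
    rcases le_total a b with h | h
    · left; constructor <;> nlinarith
    · right; constructor <;> nlinarith
  have step (k : ℕ) : k ≤ n → HasIntegralLifts V s c a (a + k / n * (b - a)) := by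
    induction k with
    | zero => intro _; simpa using key a left_mem_uIcc a (by simpa using hδ)
    | succ k ih =>
      intro hk
      have hk' : (k : ℝ) ≤ n := by exact_mod_cast (Nat.le_succ k).trans hk
      refine (ih ((Nat.le_succ k).trans hk)).trans
        (key _ (hmem k k.cast_nonneg hk') _ ?_) ?_
      · have : a + ((k + 1 : ℕ) : ℝ) / n * (b - a) - (a + k / n * (b - a)) = (b - a) / n := by
          push_cast; ring
        rw [this, abs_div, abs_of_pos hn0, div_lt_iff₀ hn0]
        rwa [div_lt_iff₀ hδ, mul_comm] at hn
      · have h1 : (k : ℝ) / n ≤ ((k + 1 : ℕ) : ℝ) / n := by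
          gcongr; exact Nat.le_succ k
        have h0 : 0 ≤ (k : ℝ) / n := by positivity
        rw [mem_uIcc]
        rcases le_total a b with h | h
        · left; constructor <;> nlinarith
        · right; constructor <;> nlinarith
  have := step n le_rfl
  rwa [div_self hn0.ne', one_mul, add_sub_cancel] at this

lemma IsIntegralLift.exists_extension (h : ∀ a b, HasIntegralLifts V s c a b) {γ : ℝ → M} {T : ℝ}
    (hT : 0 ≤ T) (hγ : IsIntegralLift V s c γ (Icc (-T) T)) :
    ∃ γ', IsIntegralLift V s c γ' (Icc (-(T + 1)) (T + 1)) ∧ EqOn γ' γ (Icc (-T) T) := by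
  have hT' : -T ≤ T := by linarith
  obtain ⟨γ₁, h₁, l₁⟩ := h T (T + 1) (γ T) (hγ.2 T (right_mem_Icc.2 hT'))
  obtain ⟨γ₂, h₂, l₂⟩ := h (-T) (-(T + 1)) (γ (-T)) (hγ.2 _ (left_mem_Icc.2 hT'))
  rw [uIcc_of_le (by linarith)] at l₁
  rw [uIcc_of_ge (by linarith)] at l₂
  obtain ⟨γ₃, e₃, -, l₃⟩ := hγ.concat l₁ (fun _ h ↦ h.2) (fun _ h ↦ h.1)
    (right_mem_Icc.2 hT') (left_mem_Icc.2 (by linarith)) h₁.symm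
  rw [Icc_union_Icc_eq_Icc hT' (by linarith)] at l₃
  obtain ⟨γ₄, -, e₄, l₄⟩ := l₂.concat l₃ (fun _ h ↦ h.2) (fun _ h ↦ h.1)
    (right_mem_Icc.2 (by linarith)) (left_mem_Icc.2 (by linarith))
    (by rw [h₂, e₃ (left_mem_Icc.2 hT')])
  rw [Icc_union_Icc_eq_Icc (by linarith) (by linarith)] at l₄
  exact ⟨γ₄, l₄, fun τ hτ ↦ by rw [e₄ ⟨hτ.1, by linarith [hτ.2]⟩, e₃ hτ]⟩

/-- Lifts on `[-n, n]` are chosen recursively, each extending the previous one. The limit path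
agrees near each time with one of them, so it needs no uniqueness of integral paths. -/
lemma exists_isMIntegralCurve_of_hasIntegralLifts (h : ∀ a b, HasIntegralLifts V s c a b) {g : M}
    (hg : s g = c 0) : ∃ γ : ℝ → M, γ 0 = g ∧ IsMIntegralCurve γ V := by
  obtain ⟨γ₀, h0, l₀⟩ := h 0 0 g hg
  have step (n : ℕ) (γ : {γ : ℝ → M // IsIntegralLift V s c γ (Icc (-n) n)}) :
      ∃ γ' : {γ : ℝ → M // IsIntegralLift V s c γ (Icc (-((n + 1 : ℕ) : ℝ)) (n + 1 : ℕ))},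
        EqOn γ'.1 γ.1 (Icc (-n) n) := by
    obtain ⟨γ', hγ', e⟩ := γ.2.exists_extension h n.cast_nonneg
    exact ⟨⟨γ', by push_cast; exact hγ'⟩, e⟩
  choose next hnext using step
  let f (n : ℕ) : {γ : ℝ → M // IsIntegralLift V s c γ (Icc (-n) n)} :=
    Nat.rec ⟨γ₀, by simpa using l₀⟩ (fun n γ ↦ next n γ) n
  have hf (n : ℕ) : EqOn (f (n + 1)).1 (f n).1 (Icc (-n) n) := hnext n (f n)
  have hle {m n : ℕ} (hmn : m ≤ n) : EqOn (f n).1 (f m).1 (Icc (-m) m) := by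
    induction n, hmn using Nat.le_induction with
    | base => exact fun _ _ ↦ rfl
    | succ n hmn ih =>
      intro τ hτ
      have : (m : ℝ) ≤ n := by exact_mod_cast hmn
      rw [hf n ⟨by linarith [hτ.1], by linarith [hτ.2]⟩, ih hτ]
  -- The index `⌊|τ|⌋₊ + 1` exceeds `|τ|`, so `τ` lies in the interval of that stage.
  let γ (τ : ℝ) : M := (f (⌊|τ|⌋₊ + 1)).1 τ
  have hγ (n : ℕ) : EqOn γ (f n).1 (Icc (-n) n) := by
    intro τ hτ
    have hlt : |τ| < (⌊|τ|⌋₊ + 1 : ℕ) := by push_cast; exact Nat.lt_floor_add_one _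
    rcases le_total n (⌊|τ|⌋₊ + 1) with hn | hn
    · exact hle hn hτ
    · exact (hle hn (abs_le.1 hlt.le)).symm
  refine ⟨γ, ?_, fun τ ↦ ?_⟩
  · rw [hγ 0 (by simp)]
    exact h0
  · obtain ⟨n, hn⟩ := exists_nat_gt |τ|
    have hmem : Icc (-(n : ℝ)) n ∈ 𝓝 τ := Icc_mem_nhds (abs_lt.1 hn).1 (abs_lt.1 hn).2
    have hτ := mem_of_mem_nhds hmem
    have : HasVelocityAt I γ (V (γ τ)) τ := by
      rw [hγ n hτ]
      exact HasVelocityAt.congr_of_eventuallyEq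
        (HasVelocityWithinAt.hasVelocityAt ((f n).2.1 τ hτ) hmem)
        (Filter.eventually_of_mem hmem (hγ n))
    exact this

end Gluing

/-! ### The equivalence, given fibre curves and uniform local integral paths at the units. -/

section LieCategories

variable {E H F K : Type*} [NormedAddCommGroup E] [NormedSpace ℝ E] [TopologicalSpace H]
  [NormedAddCommGroup F] [NormedSpace ℝ F] [TopologicalSpace K]
  {I : ModelWithCorners ℝ E H} {J : ModelWithCorners ℝ F K}
  {C : Type*} [TopologicalSpace C] [ChartedSpace H C]
  {X : Type*} [TopologicalSpace X] [ChartedSpace K X]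

namespace LieCategory.LeftAlgebroidSection

variable [IsManifold I ∞ C] {𝒞 : LieCategory I J C X} {α : 𝒞.LeftAlgebroidSection}

lemma contMDiff_anchor [IsManifold J ∞ X] (α : 𝒞.LeftAlgebroidSection) :
    ContMDiff J J.tangent ∞ (fun x ↦ (⟨x, α.anchor x⟩ : TangentBundle J X)) := by
  have h := (𝒞.smooth_s.contMDiff_tangentMap (m := ∞) (by simp)).comp α.smooth
  convert h using 1
  ext1 x
  -- The tangent map of `s` lands over `s (u x)`, which is equal to `x` but not definitionally.
  have e (y : X) (hy : x = y) (v : F) :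
      (⟨x, v⟩ : TangentBundle J X) = ⟨y, v⟩ := by subst hy; rfl
  exact e _ (𝒞.s_unit x).symm _

lemma isCompleteVectorField_anchor (hα : ∀ x, ∃ σ, α.IsFibreCurve x σ)
    (h : IsCompleteVectorField I α.leftExtension) : IsCompleteVectorField J α.anchor := by
  intro x
  obtain ⟨γ, h0, hγ⟩ := h (𝒞.u x)
  refine ⟨𝒞.s ∘ γ, by rw [Function.comp_apply, h0, 𝒞.s_unit], ?_⟩
  rw [isMIntegralCurve_iff_isMIntegralCurveOn] at hγ ⊢
  exact isMIntegralCurveOn_s_comp hα hγ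

variable [J.Boundaryless] [IsManifold J ∞ X] [T2Space X]

/-- The curve `t ∘ γ` and a constant curve are both integral paths of the zero field on the base, so
uniqueness there identifies them. -/
lemma t_eq_of_isMIntegralCurveOn (hα : ∀ x, ∃ σ, α.IsFibreCurve x σ) {γ : ℝ → C} {ε : ℝ}
    (hε : 0 < ε) (hγ : IsMIntegralCurveOn γ α.leftExtension (Ioo (-ε) ε)) {τ : ℝ}
    (hτ : τ ∈ Ioo (-ε) ε) : 𝒞.t (γ τ) = 𝒞.t (γ 0) := by
  have : IsManifold J 1 X := IsManifold.of_le (n := ∞) (by simp)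
  exact isMIntegralCurveOn_Ioo_eqOn_of_contMDiff_boundaryless (t₀ := 0) (γ := 𝒞.t ∘ γ)
    (γ' := fun _ ↦ 𝒞.t (γ 0)) (v := fun x ↦ (0 : TangentSpace J x)) ⟨by linarith, hε⟩
    (Bundle.contMDiff_zeroSection ℝ (TangentSpace J))
    (isMIntegralCurveOn_t_comp hα hγ)
    (fun τ _ ↦ (hasVelocityAt_const _).hasVelocityWithinAt) rfl hτ

/-- Left translation carries the local paths at units to every starting point without shortening
them, so the time of existence is locally uniform along `c`. -/
lemma isCompleteVectorField_leftExtension (hα : ∀ x, ∃ σ, α.IsFibreCurve x σ)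
    (hflow : ∀ x₀, ∃ ε > 0, ∀ᶠ y in 𝓝 x₀, ∃ γ : ℝ → C, γ 0 = 𝒞.u y ∧
      IsMIntegralCurveOn γ α.leftExtension (Ioo (-ε) ε))
    (h : IsCompleteVectorField J α.anchor) : IsCompleteVectorField I α.leftExtension := by
  have : IsManifold J 1 X := IsManifold.of_le (n := ∞) (by simp)
  intro g
  obtain ⟨c, hc0, hc⟩ := h (𝒞.s g)
  refine exists_isMIntegralCurve_of_hasIntegralLifts (s := 𝒞.s) (c := c)
    (hasIntegralLifts_of_forall_exists fun τ₀ ↦ ?_) hc0.symm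
  obtain ⟨ε, hε, hev⟩ := hflow (c τ₀)
  have hcτ : ContinuousAt c τ₀ := HasVelocityAt.continuousAt (hc τ₀)
  -- The radius `ε / 2` ensures `|b - a| < ε`, so a path of time `ε` started at time `a` reaches
  -- `b`.
  refine ⟨{τ | ∃ γ : ℝ → C, γ 0 = 𝒞.u (c τ) ∧
      IsMIntegralCurveOn γ α.leftExtension (Ioo (-ε) ε)} ∩ Ioo (τ₀ - ε / 2) (τ₀ + ε / 2),
    Filter.inter_mem (hcτ.eventually hev) (Ioo_mem_nhds (by linarith) (by linarith)), ?_⟩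
  rintro a ⟨⟨γ, hγ0, hγ⟩, ha⟩ b ⟨-, hb⟩ k hk
  have ht (τ) (hτ : τ ∈ Ioo (-ε) ε) : 𝒞.t (γ τ) = 𝒞.s k := by
    rw [t_eq_of_isMIntegralCurveOn hα hε hγ hτ, hγ0, 𝒞.t_unit, hk]
  have hshift : IsMIntegralCurveOn (fun τ ↦ γ (τ - a)) α.leftExtension (Ioo (a - ε) (a + ε)) := by
    intro τ hτ
    have hτ' : τ - a ∈ Ioo (-ε) ε := ⟨by linarith [hτ.1], by linarith [hτ.2]⟩
    exact HasVelocityAt.hasVelocityWithinAt (HasVelocityAt.comp_sub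
      (HasVelocityWithinAt.hasVelocityAt (hγ _ hτ') (Ioo_mem_nhds hτ'.1 hτ'.2)))
  have hmem (τ) (hτ : τ ∈ Ioo (a - ε) (a + ε)) : τ - a ∈ Ioo (-ε) ε :=
    ⟨by linarith [hτ.1], by linarith [hτ.2]⟩
  have hs : EqOn (𝒞.s ∘ fun τ ↦ γ (τ - a)) c (Ioo (a - ε) (a + ε)) :=
    isMIntegralCurveOn_Ioo_eqOn_of_contMDiff_boundaryless (t₀ := a)
      ⟨by linarith, by linarith⟩ (α.contMDiff_anchor.of_le (by simp))
      (isMIntegralCurveOn_s_comp hα hshift) (hc.isMIntegralCurveOn _)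
      (by simp [hγ0, 𝒞.s_unit])
  have hsub : uIcc a b ⊆ Ioo (a - ε) (a + ε) := by
    intro τ hτ
    rcases mem_uIcc.1 hτ with hτ | hτ <;> constructor <;>
      linarith [hτ.1, hτ.2, ha.1, ha.2, hb.1, hb.2]
  -- The path from the unit at `c a = s k`, translated in time and then by `k`; it starts at `k
  -- 1_{s(k)} = k`.
  refine ⟨fun τ ↦ 𝒞.comp k (γ (τ - a)), ?_, ?_, fun τ hτ ↦ ?_⟩
  · simp only [sub_self]
    rw [hγ0, ← hk, 𝒞.comp_unit]
  · exact (isMIntegralCurveOn_comp hα hshift fun τ hτ ↦ ht _ (hmem τ hτ)).mono hsub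
  · rw [𝒞.s_comp _ _ (ht _ (hmem τ (hsub hτ))).symm]
    exact hs (hsub hτ)

end LieCategory.LeftAlgebroidSection

end LieCategories

/-! ### Uniform Picard–Lindelöf and straightening of a submersion. -/

section Calculus

variable {W F : Type*} [NormedAddCommGroup W] [NormedSpace ℝ W]
  [NormedAddCommGroup F] [NormedSpace ℝ F]

/-- The partial derivative in the direction of a real parameter loses one degree of smoothness. -/
lemma ContDiffAt.fderiv_apply_inr {m : W × ℝ → W} {e₀ : W} (hm : ContDiffAt ℝ 2 m (e₀, 0)) :
    ContDiffAt ℝ 1 (fun e ↦ fderiv ℝ m (e, 0) (0, 1)) e₀ := by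
  have h1 : ContDiffAt ℝ 1 (fderiv ℝ m) (e₀, 0) := hm.fderiv_right (by norm_num)
  exact (h1.comp (f := fun e : W ↦ (e, (0 : ℝ))) e₀
    (contDiffAt_id.prodMk contDiffAt_const)).clm_apply contDiffAt_const

variable [CompleteSpace W]

/-- Picard–Lindelöf with uniform time of existence and solutions in a prescribed neighbourhood. -/
lemma ContDiffAt.exists_forall_eventually_hasDerivAt_mem {V : W → W} {e₀ : W}
    (hV : ContDiffAt ℝ 1 V e₀) {O : Set W} (hO : O ∈ 𝓝 e₀) :
    ∃ ε > 0, ∀ᶠ e in 𝓝 e₀, ∃ c : ℝ → W, c 0 = e ∧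
      ∀ τ ∈ Ioo (-ε) ε, HasDerivAt c (V (c τ)) τ ∧ c τ ∈ O := by
  obtain ⟨δ, hδ, a, r, L, K, hr, hpl⟩ := IsPicardLindelof.of_contDiffAt_one hV
  obtain ⟨α, h1, h2⟩ := (hpl 0).exists_forall_mem_closedBall_eq_hasDerivWithinAt_continuousOn
  simp only [zero_sub, zero_add] at h1 h2
  have hr' : Metric.closedBall e₀ r ∈ 𝓝 e₀ := Metric.closedBall_mem_nhds _ (by exact_mod_cast hr)
  have hcont : ContinuousAt α (e₀, 0) :=
    h2.continuousAt (prod_mem_nhds hr' (Icc_mem_nhds (by linarith) hδ))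
  have h0 : α (e₀, 0) = e₀ := (h1 e₀ (mem_of_mem_nhds hr')).1
  -- Joint continuity of the flow at `(e₀, 0)` keeps solutions in `O` after shrinking both the
  -- initial ball and the time.
  have hev := hcont.eventually (by rw [h0]; exact hO)
  rw [nhds_prod_eq] at hev
  obtain ⟨P, hP, Q, hQ, hPQ⟩ := Filter.eventually_prod_iff.1 hev
  obtain ⟨η, hη, hηQ⟩ := Metric.eventually_nhds_iff.1 hQ
  refine ⟨min δ η, lt_min hδ hη, ?_⟩
  filter_upwards [hP, hr'] with e he her
  refine ⟨fun τ ↦ α (e, τ), (h1 e her).1, fun τ hτ ↦ ?_⟩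
  have hτδ : τ ∈ Ioo (-δ) δ :=
    ⟨by linarith [hτ.1, min_le_left δ η], by linarith [hτ.2, min_le_left δ η]⟩
  refine ⟨((h1 e her).2 τ (Ioo_subset_Icc_self hτδ)).hasDerivAt (Icc_mem_nhds hτδ.1 hτδ.2),
    hPQ he (hηQ ?_)⟩
  rw [Real.dist_eq, sub_zero, abs_lt]
  exact ⟨by linarith [hτ.1, min_le_right δ η], by linarith [hτ.2, min_le_right δ η]⟩

/-- Near a point at which its derivative `L` has the right inverse `B`, the map `G` is transformed
into `L` by the local diffeomorphism `e ↦ e - B (L e) + B (G e)`. -/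
lemma ContDiffAt.exists_straightening {n : WithTop ℕ∞} (hn : n ≠ 0) {G : W → F} {L : W →L[ℝ] F}
    {B : F →L[ℝ] W} {e₀ : W} (hG : ContDiffAt ℝ n G e₀) (hL : HasFDerivAt G L e₀)
    (hB : ∀ y, L (B y) = y) :
    ∃ R : W → W, R (e₀ - B (L e₀) + B (G e₀)) = e₀ ∧
      ContDiffAt ℝ n R (e₀ - B (L e₀) + B (G e₀)) ∧
      (∀ᶠ e in 𝓝 e₀, R (e - B (L e) + B (G e)) = e) ∧
      ∀ᶠ z in 𝓝 (e₀ - B (L e₀) + B (G e₀)), G (R z) = L z := by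
  have hΘ : ContDiffAt ℝ n (fun e ↦ e - B (L e) + B (G e)) e₀ :=
    (contDiffAt_id.sub (B.contDiff.comp L.contDiff).contDiffAt).add
      (B.contDiff.contDiffAt.comp e₀ hG)
  have hΘ' : HasFDerivAt (fun e ↦ e - B (L e) + B (G e))
      ((ContinuousLinearEquiv.refl ℝ W : W ≃L[ℝ] W) : W →L[ℝ] W) e₀ := by
    -- The derivative is `id - BL + BL = id`.
    have := ((hasFDerivAt_id (𝕜 := ℝ) e₀).sub (B.comp L).hasFDerivAt).add
      (B.hasFDerivAt.comp e₀ hL)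
    rwa [sub_add_cancel] at this
  have hs := hΘ.hasStrictFDerivAt' hΘ' hn
  refine ⟨hΘ.localInverse hΘ' hn, hΘ.localInverse_apply_image hΘ' hn, hΘ.to_localInverse hΘ' hn,
    hs.eventually_left_inverse, ?_⟩
  filter_upwards [hs.eventually_right_inverse] with z hz
  change G (hs.localInverse _ _ _ z) = L z
  conv_rhs => rw [← hz]
  simp [hB]

end Calculus

/-! ### Velocities read in a chart. -/

section Chart

variable {E H : Type*} [NormedAddCommGroup E] [NormedSpace ℝ E] [TopologicalSpace H]
  {I : ModelWithCorners ℝ E H} {M : Type*} [TopologicalSpace M] [ChartedSpace H M]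
  [IsManifold I 1 M]

/-- The velocity of a curve that is given in a chart. -/
lemma hasVelocityAt_extChartAt_symm {x p : M} {c : ℝ → E} {v w : E} {τ : ℝ}
    (hp : p ∈ (extChartAt I x).source) (hc : c τ = extChartAt I x p) (hcv : HasDerivAt c v τ)
    (hcI : ∀ᶠ θ in 𝓝 τ, c θ ∈ range I)
    (hv : v = (mfderiv I 𝓘(ℝ, E) (extChartAt I x) p : E →L[ℝ] E) w) :
    HasVelocityAt I (fun θ ↦ (extChartAt I x).symm (c θ)) w τ := by
  let A : E →L[ℝ] E := mfderivWithin 𝓘(ℝ, E) I (extChartAt I x).symm (range I) (extChartAt I x p)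
  have hA : HasMFDerivWithinAt 𝓘(ℝ, E) I (extChartAt I x).symm (range I) (c τ) A := by
    rw [hc]
    exact (mdifferentiableWithinAt_extChartAt_symm
      ((extChartAt I x).map_source hp)).hasMFDerivWithinAt
  have h := HasVelocityAt.map_within hA (hasVelocityAt_iff_hasDerivAt.2 hcv) hcI
  have e : A v = w := by
    rw [hv]
    exact DFunLike.congr_fun (mfderivWithin_extChartAt_symm_comp_mfderiv_extChartAt' hp) w
  rwa [e] at h

end Chart

lemma two_le_infty : (2 : WithTop ℕ∞) ≤ ∞ := by
  exact WithTop.coe_le_coe.2 (le_top : (2 : ℕ∞) ≤ ⊤)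

/-! ### Fibre curves and local integral paths from a parametrization at a unit. -/

section LieCategories

variable {E H F K : Type*} [NormedAddCommGroup E] [NormedSpace ℝ E] [TopologicalSpace H]
  [NormedAddCommGroup F] [NormedSpace ℝ F] [TopologicalSpace K]
  {I : ModelWithCorners ℝ E H} {J : ModelWithCorners ℝ F K}
  {C : Type*} [TopologicalSpace C] [ChartedSpace H C]
  {X : Type*} [TopologicalSpace X] [ChartedSpace K X]

namespace LieCategory.LeftAlgebroidSection

variable [IsManifold I ∞ C] {𝒞 : LieCategory I J C X}

/-- A local parametrization `ψ`, with local inverse `κ`, by a vector space `W`, of a subcategory `S`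
near the unit at `x₀`. The restriction of `t` to `S` is a submersion at the unit, and the section
`α` is tangent to `S`, with coordinate expression `a`. -/
structure UnitParametrization (α : 𝒞.LeftAlgebroidSection) (x₀ : X) (W : Type*)
    [NormedAddCommGroup W] [NormedSpace ℝ W] (S : Set C) where
  /-- the parametrization -/
  ψ : W → C
  /-- the coordinates -/
  κ : C → W
  /-- the coordinate expression of the section -/
  a : X → W
  /-- the derivative of `t` in coordinates -/
  L : W →L[ℝ] F
  /-- a right inverse of the derivative of `t` -/
  B : F →L[ℝ] W
  unit_mem : ∀ x, 𝒞.u x ∈ S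
  comp_mem : ∀ g ∈ S, ∀ h ∈ S, 𝒞.s g = 𝒞.t h → 𝒞.comp g h ∈ S
  smooth_ψ : ContMDiffAt 𝓘(ℝ, W) I 2 ψ (κ (𝒞.u x₀))
  smooth_κ : ContMDiffAt I 𝓘(ℝ, W) 2 κ (𝒞.u x₀)
  smooth_a : ContMDiffAt J 𝓘(ℝ, W) 2 a x₀
  ψ_mem : ∀ᶠ e in 𝓝 (κ (𝒞.u x₀)), ψ e ∈ S
  κ_ψ : ∀ᶠ e in 𝓝 (κ (𝒞.u x₀)), κ (ψ e) = e
  ψ_κ : ∀ᶠ p in 𝓝 (𝒞.u x₀), p ∈ S → ψ (κ p) = p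
  hasFDerivAt_t : HasFDerivAt (fun e ↦ extChartAt J x₀ (𝒞.t (ψ e))) L (κ (𝒞.u x₀))
  L_B : ∀ y, L (B y) = y
  velocity : ∀ᶠ x in 𝓝 x₀, ∀ c : ℝ → W, c 0 = κ (𝒞.u x) → HasDerivAt c (a x) 0 →
    HasVelocityAt I (fun θ ↦ ψ (c θ)) (α.toFun x : E) 0

namespace UnitParametrization

variable {α : 𝒞.LeftAlgebroidSection} {x₀ : X} {W : Type*}
  [NormedAddCommGroup W] [NormedSpace ℝ W] {S : Set C}

lemma ψ_κ_unit (P : α.UnitParametrization x₀ W S) : P.ψ (P.κ (𝒞.u x₀)) = 𝒞.u x₀ :=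
  P.ψ_κ.self_of_nhds (P.unit_mem x₀)

lemma contDiffAt_t (P : α.UnitParametrization x₀ W S) :
    ContDiffAt ℝ 2 (fun e ↦ extChartAt J x₀ (𝒞.t (P.ψ e))) (P.κ (𝒞.u x₀)) := by
  rw [← contMDiffAt_iff_contDiffAt]
  have h1 : ContMDiffAt J 𝓘(ℝ, F) 2 (extChartAt J x₀) x₀ := contMDiffAt_extChartAt
  have h2 : ContMDiffAt 𝓘(ℝ, W) J 2 (𝒞.t ∘ P.ψ) (P.κ (𝒞.u x₀)) :=
    (𝒞.smooth_t.contMDiffAt.of_le two_le_infty).comp _ P.smooth_ψ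
  exact h1.comp_of_eq h2 (by rw [P.ψ_κ_unit, 𝒞.t_unit])

variable [IsManifold J ∞ X]

/-- The section is represented by a smooth family of curves in the `t`-fibres. -/
lemma exists_fibreCurves [CompleteSpace W] (P : α.UnitParametrization x₀ W S) :
    ∃ σ : X → ℝ → C,
      ContMDiffAt (J.prod 𝓘(ℝ, ℝ)) I 2 (fun p : X × ℝ ↦ σ p.1 p.2) (x₀, 0) ∧
      (∀ᶠ p : X × ℝ in 𝓝 (x₀, 0), 𝒞.t (σ p.1 p.2) = p.1 ∧ σ p.1 p.2 ∈ S) ∧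
      ∀ᶠ x in 𝓝 x₀, α.IsFibreCurve x (σ x) := by
  have : IsManifold I 1 C := IsManifold.of_le (n := ∞) (by simp)
  have : IsManifold J 1 X := IsManifold.of_le (n := ∞) (by simp)
  set e₀ := P.κ (𝒞.u x₀) with he₀
  set G : W → F := fun e ↦ extChartAt J x₀ (𝒞.t (P.ψ e)) with hG
  have hGs : ContDiffAt ℝ 2 G e₀ := P.contDiffAt_t
  obtain ⟨R, hR0, hRs, hRΘ, hGR⟩ := hGs.exists_straightening (by simp) P.hasFDerivAt_t P.L_B
  set Θ : W → W := fun e ↦ e - P.B (P.L e) + P.B (G e) with hΘ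
  have hΘs : ContDiffAt ℝ 2 Θ e₀ :=
    (contDiffAt_id.sub (P.B.contDiff.comp P.L.contDiff).contDiffAt).add
      (P.B.contDiff.contDiffAt.comp e₀ hGs)
  change R (Θ e₀) = e₀ at hR0
  change ContDiffAt ℝ 2 R (Θ e₀) at hRs
  change ∀ᶠ e in 𝓝 e₀, R (Θ e) = e at hRΘ
  change ∀ᶠ z in 𝓝 (Θ e₀), G (R z) = P.L z at hGR
  have hκu : ContMDiffAt J 𝓘(ℝ, W) 2 (fun x ↦ P.κ (𝒞.u x)) x₀ :=
    P.smooth_κ.comp x₀ (𝒞.smooth_u.contMDiffAt.of_le two_le_infty)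
  -- The component of `a` in `ker L`; for `x` near `x₀` it equals `DΘ a`, since `DG a = 0`.
  let b : X → W := fun x ↦ P.a x - P.B (P.L (P.a x))
  have hb : ContMDiffAt J 𝓘(ℝ, W) 2 b x₀ :=
    ((contDiff_id.sub (P.B.contDiff.comp P.L.contDiff)).contMDiff.contMDiffAt).comp x₀ P.smooth_a
  -- In straightened coordinates `t` is the linear map `L`, so a line in a direction of `ker L`
  -- stays in a `t`-fibre.
  let z : X × ℝ → W := fun p ↦ Θ (P.κ (𝒞.u p.1)) + p.2 • b p.1
  have hz0 : z (x₀, 0) = Θ e₀ := by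
    change Θ e₀ + (0 : ℝ) • b x₀ = Θ e₀
    rw [zero_smul, add_zero]
  have hzs : ContMDiffAt (J.prod 𝓘(ℝ, ℝ)) 𝓘(ℝ, W) 2 z (x₀, 0) := by
    have h1 : ContMDiffAt J 𝓘(ℝ, W) 2 (fun x ↦ Θ (P.κ (𝒞.u x))) x₀ :=
      hΘs.contMDiffAt.comp x₀ hκu
    have h1' : ContMDiffAt (J.prod 𝓘(ℝ, ℝ)) 𝓘(ℝ, W) 2
        (fun p : X × ℝ ↦ Θ (P.κ (𝒞.u p.1))) (x₀, 0) :=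
      h1.comp (x₀, (0 : ℝ)) contMDiffAt_fst
    have h2 : ContMDiffAt (J.prod 𝓘(ℝ, ℝ)) 𝓘(ℝ, W) 2 (fun p : X × ℝ ↦ b p.1) (x₀, 0) :=
      hb.comp (x₀, (0 : ℝ)) contMDiffAt_fst
    exact h1'.add (contMDiffAt_snd.smul h2)
  have hRz : ContMDiffAt (J.prod 𝓘(ℝ, ℝ)) 𝓘(ℝ, W) 2 (fun p ↦ R (z p)) (x₀, 0) :=
    hRs.contMDiffAt.comp_of_eq hzs hz0
  have hRz0 : R (z (x₀, 0)) = e₀ := by rw [hz0, hR0]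
  have hσ : ContMDiffAt (J.prod 𝓘(ℝ, ℝ)) I 2 (fun p ↦ P.ψ (R (z p))) (x₀, 0) :=
    P.smooth_ψ.comp_of_eq hRz hRz0
  have hσ0 : P.ψ (R (z (x₀, 0))) = 𝒞.u x₀ := by rw [hRz0, P.ψ_κ_unit]
  have hux : Filter.Tendsto 𝒞.u (𝓝 x₀) (𝓝 (𝒞.u x₀)) := 𝒞.smooth_u.continuous.continuousAt
  have hκux : Filter.Tendsto (fun x ↦ P.κ (𝒞.u x)) (𝓝 x₀) (𝓝 e₀) := hκu.continuousAt
  have hfst : Filter.Tendsto (Prod.fst : X × ℝ → X) (𝓝 (x₀, 0)) (𝓝 x₀) := continuousAt_fst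
  have hψκ : ∀ᶠ x in 𝓝 x₀, P.ψ (P.κ (𝒞.u x)) = 𝒞.u x :=
    (hux.eventually P.ψ_κ).mono fun x hx ↦ hx (P.unit_mem x)
  have hLb (x : X) : P.L (b x) = 0 := by simp [b, P.L_B]
  have hLΘ (e : W) : P.L (Θ e) = G e := by simp [hΘ, P.L_B]
  have ht : ∀ᶠ p : X × ℝ in 𝓝 (x₀, 0), 𝒞.t (P.ψ (R (z p))) = p.1 := by
    have hsrc : ∀ᶠ x in 𝓝 x₀, x ∈ (extChartAt J x₀).source := extChartAt_source_mem_nhds x₀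
    have htσ : Filter.Tendsto (fun p ↦ 𝒞.t (P.ψ (R (z p)))) (𝓝 (x₀, 0)) (𝓝 x₀) := by
      have := 𝒞.smooth_t.continuous.continuousAt.comp hσ.continuousAt
      simp only [ContinuousAt, Function.comp_def] at this
      rwa [hσ0, 𝒞.t_unit] at this
    have hzt : Filter.Tendsto z (𝓝 (x₀, 0)) (𝓝 (Θ e₀)) := by
      have := hzs.continuousAt
      rwa [ContinuousAt, hz0] at this
    filter_upwards [hfst.eventually hsrc, htσ.eventually hsrc, hzt.eventually hGR,
      hfst.eventually hψκ] with p h1 h2 h3 h4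
    refine (extChartAt J x₀).injOn h2 h1 ?_
    change G (R (z p)) = _
    rw [h3, map_add, map_smul, hLb, smul_zero, add_zero, hLΘ]
    change extChartAt J x₀ (𝒞.t (P.ψ (P.κ (𝒞.u p.1)))) = _
    rw [h4, 𝒞.t_unit]
  have hS : ∀ᶠ p in 𝓝 ((x₀, 0) : X × ℝ), P.ψ (R (z p)) ∈ S := by
    have := hRz.continuousAt
    rw [ContinuousAt, hRz0] at this
    exact this.eventually P.ψ_mem
  refine ⟨fun x θ ↦ P.ψ (R (z (x, θ))), hσ, ht.and hS, ?_⟩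
  have ht' : ∀ᶠ x in 𝓝 x₀, ∀ᶠ θ in 𝓝 (0 : ℝ), 𝒞.t (P.ψ (R (z (x, θ)))) = x :=
    Filter.Eventually.curry (by rwa [nhds_prod_eq] at ht)
  filter_upwards [extChartAt_source_mem_nhds (I := J) x₀, hψκ, ht',
    hκux.eventually hRΘ, hκux.eventually hRΘ.eventually_nhds, P.velocity,
    hκux.eventually (hGs.eventually (by simp)),
    hκux.eventually ((hΘs.continuousAt).eventually (hRs.eventually (by simp)))]
    with x hx h1 h2 h3 h4 hvel hGx hRx
  have hz (x) : z (x, 0) = Θ (P.κ (𝒞.u x)) := by simp [z]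
  refine ⟨by rw [hz, h3, h1], h2, hvel _ (by rw [hz, h3]) ?_⟩
  -- The image under `ψ` of the line in direction `a x` has velocity `α x`, which `dt` kills.
  have hGa : fderiv ℝ G (P.κ (𝒞.u x)) (P.a x) = 0 := by
    have hline : HasDerivAt (fun θ : ℝ ↦ P.κ (𝒞.u x) + θ • P.a x) (P.a x) 0 := by
      simpa using ((hasDerivAt_id (0 : ℝ)).smul_const (P.a x)).const_add (P.κ (𝒞.u x))
    have hl0 : P.κ (𝒞.u x) + (0 : ℝ) • P.a x = P.κ (𝒞.u x) := by rw [zero_smul, add_zero]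
    have v1 := (hvel _ hl0 hline).map_mfderiv (𝒞.mdifferentiable_t _)
    have e1 : 𝒞.t (P.ψ (P.κ (𝒞.u x) + (0 : ℝ) • P.a x)) = x := by rw [hl0, h1, 𝒞.t_unit]
    rw [hl0, h1] at v1
    have e2 : (mfderiv I J 𝒞.t (𝒞.u x) : E →L[ℝ] F) (α.toFun x) = 0 := α.mem_ker x
    rw [e2] at v1
    obtain ⟨A, hA⟩ : ∃ A : F →L[ℝ] F, HasMFDerivAt J 𝓘(ℝ, F) (extChartAt J x₀)
        ((𝒞.t ∘ fun θ : ℝ ↦ P.ψ (P.κ (𝒞.u x) + θ • P.a x)) 0) A := by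
      rw [Function.comp_apply, e1]
      exact ⟨_, hasMFDerivAt_extChartAt (by rwa [extChartAt_source] at hx)⟩
    have v2 := HasVelocityAt.map (v := (0 : F)) hA v1
    have e3 : A (0 : F) = 0 := map_zero A
    rw [e3] at v2
    have v3 : HasDerivAt (fun θ : ℝ ↦ G (P.κ (𝒞.u x) + θ • P.a x)) 0 0 :=
      hasVelocityAt_iff_hasDerivAt.1 v2
    have hGd : HasFDerivAt G (fderiv ℝ G (P.κ (𝒞.u x))) (P.κ (𝒞.u x) + (0 : ℝ) • P.a x) := by
      rw [hl0]
      exact (hGx.differentiableAt (by simp)).hasFDerivAt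
    have v4 := hGd.comp_hasDerivAt 0 hline
    exact v4.unique v3
  have hΘd : HasFDerivAt Θ (ContinuousLinearMap.id ℝ W - P.B.comp P.L +
      P.B.comp (fderiv ℝ G (P.κ (𝒞.u x)))) (P.κ (𝒞.u x)) :=
    ((hasFDerivAt_id _).sub (P.B.comp P.L).hasFDerivAt).add
      (P.B.hasFDerivAt.comp _ (hGx.differentiableAt (by simp)).hasFDerivAt)
  have hRd := (hRx.differentiableAt (by simp)).hasFDerivAt
  -- Differentiate `R ∘ Θ = id` in the direction `a x`, using `DΘ a = b`.
  have hRb : fderiv ℝ R (Θ (P.κ (𝒞.u x))) (b x) = P.a x := by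
    have := (hRd.comp _ hΘd).unique ((hasFDerivAt_id _).congr_of_eventuallyEq h4)
    have := DFunLike.congr_fun this (P.a x)
    simpa [hGa, b] using this
  have hline : HasDerivAt (fun θ : ℝ ↦ z (x, θ)) (b x) 0 := by
    change HasDerivAt (fun θ : ℝ ↦ Θ (P.κ (𝒞.u x)) + θ • b x) (b x) 0
    simpa using ((hasDerivAt_id (0 : ℝ)).smul_const (b x)).const_add (Θ (P.κ (𝒞.u x)))
  rw [← hz] at hRd
  have := hRd.comp_hasDerivAt 0 hline
  rwa [hz, hRb] at this

/-- The left-invariant extension is locally integrable along the units, with a uniform time. -/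
lemma exists_flow [CompleteSpace W] (P : α.UnitParametrization x₀ W S) :
    ∃ ε > 0, ∀ᶠ y in 𝓝 x₀, ∃ γ : ℝ → C, γ 0 = 𝒞.u y ∧
      IsMIntegralCurveOn γ α.leftExtension (Ioo (-ε) ε) := by
  have : IsManifold I 1 C := IsManifold.of_le (n := ∞) (by simp)
  have : IsManifold I 2 C := IsManifold.of_le (n := ∞) two_le_infty
  obtain ⟨σ, hσ, hσtS, hσf⟩ := P.exists_fibreCurves
  set e₀ := P.κ (𝒞.u x₀) with he₀
  have hψ0 : P.ψ e₀ = 𝒞.u x₀ := P.ψ_κ_unit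
  have hs : ContMDiffAt 𝓘(ℝ, W) J 2 (fun e ↦ 𝒞.s (P.ψ e)) e₀ :=
    (𝒞.smooth_s.contMDiffAt.of_le two_le_infty).comp _ P.smooth_ψ
  have hs0 : 𝒞.s (P.ψ e₀) = x₀ := by rw [hψ0, 𝒞.s_unit]
  have hst : Filter.Tendsto (fun e ↦ 𝒞.s (P.ψ e)) (𝓝 e₀) (𝓝 x₀) := by
    have := hs.continuousAt
    rwa [ContinuousAt, hs0] at this
  have hσ0 : σ x₀ 0 = 𝒞.u x₀ := hσf.self_of_nhds.zero
  let q : W × ℝ → C × C := fun p ↦ (P.ψ p.1, σ (𝒞.s (P.ψ p.1)) p.2)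
  have hst2 : Filter.Tendsto (fun p : W × ℝ ↦ (𝒞.s (P.ψ p.1), p.2)) (𝓝 (e₀, 0)) (𝓝 (x₀, 0)) := by
    rw [nhds_prod_eq, nhds_prod_eq]
    exact hst.prodMap Filter.tendsto_id
  have hq0 : q (e₀, 0) = (𝒞.u x₀, 𝒞.u x₀) := by simp only [q, hψ0, 𝒞.s_unit, hσ0]
  have hq : ContMDiffAt (𝓘(ℝ, W).prod 𝓘(ℝ, ℝ)) (I.prod I) 2 q (e₀, 0) := by
    have h1 : ContMDiffAt (𝓘(ℝ, W).prod 𝓘(ℝ, ℝ)) I 2 (fun p : W × ℝ ↦ P.ψ p.1) (e₀, 0) :=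
      P.smooth_ψ.comp_of_eq contMDiffAt_fst rfl
    have h2 : ContMDiffAt (𝓘(ℝ, W).prod 𝓘(ℝ, ℝ)) J 2
        (fun p : W × ℝ ↦ 𝒞.s (P.ψ p.1)) (e₀, 0) :=
      hs.comp_of_eq (f := Prod.fst) (g := fun e ↦ 𝒞.s (P.ψ e)) contMDiffAt_fst rfl
    have h3 : ContMDiffAt (𝓘(ℝ, W).prod 𝓘(ℝ, ℝ)) I 2
        (fun p : W × ℝ ↦ σ (𝒞.s (P.ψ p.1)) p.2) (e₀, 0) :=
      hσ.comp_of_eq (h2.prodMk contMDiffAt_snd) (by rw [hs0])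
    exact h1.prodMk h3
  have hqT : ∀ᶠ p in 𝓝 ((e₀, 0) : W × ℝ), q p ∈ {p : C × C | 𝒞.s p.1 = 𝒞.t p.2} :=
    (hst2.eventually hσtS).mono fun p hp ↦ hp.1.symm
  -- For fixed `e`, this is the curve `gσ` with `g = ψ e`; its velocity at time `0` is `α^L(ψ e)`.
  let k : W × ℝ → C := fun p ↦ 𝒞.comp (q p).1 (q p).2
  have hk : ContMDiffAt (𝓘(ℝ, W).prod 𝓘(ℝ, ℝ)) I 2 k (e₀, 0) := by
    have h1 : ContMDiffWithinAt (I.prod I) I 2 (fun p : C × C ↦ 𝒞.comp p.1 p.2)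
        {p | 𝒞.s p.1 = 𝒞.t p.2} (q (e₀, 0)) :=
      (𝒞.smooth_comp _ hqT.self_of_nhds).of_le two_le_infty
    exact (h1.comp (s := q ⁻¹' {p : C × C | 𝒞.s p.1 = 𝒞.t p.2}) (e₀, (0 : ℝ))
      hq.contMDiffWithinAt fun _ h ↦ h).contMDiffAt hqT
  have hk0 : k (e₀, 0) = 𝒞.u x₀ := by
    change 𝒞.comp (q (e₀, 0)).1 (q (e₀, 0)).2 = _
    rw [hq0]
    simpa only [𝒞.s_unit] using 𝒞.comp_unit (𝒞.u x₀)
  have hm : ContDiffAt ℝ 2 (fun p ↦ P.κ (k p)) ((e₀, 0) : W × ℝ) := by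
    have h1 : ContMDiffAt (𝓘(ℝ, W).prod 𝓘(ℝ, ℝ)) 𝓘(ℝ, W) 2 (fun p ↦ P.κ (k p)) (e₀, 0) :=
      P.smooth_κ.comp_of_eq hk hk0
    rw [← modelWithCornersSelf_prod, chartedSpaceSelf_prod] at h1
    exact h1.contDiffAt
  -- The coordinate expression of `α^L` along `S`. As `k` is `C²`, the field `V` is `C¹`, as
  -- Picard–Lindelöf requires.
  let V : W → W := fun e ↦ fderiv ℝ (fun p ↦ P.κ (k p)) (e, 0) (0, 1)
  have hV : ContDiffAt ℝ 1 V e₀ := hm.fderiv_apply_inr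
  have hinr : Filter.Tendsto (fun e : W ↦ (e, (0 : ℝ))) (𝓝 e₀) (𝓝 (e₀, 0)) :=
    Continuous.tendsto (by fun_prop) e₀
  -- Closure of `S` under composition is decisive here: it keeps `k` in `S`, where `κ` loses no
  -- information.
  have hkS : ∀ᶠ p in 𝓝 ((e₀, 0) : W × ℝ), P.ψ (P.κ (k p)) = k p := by
    have hkt := hk.continuousAt
    rw [ContinuousAt, hk0] at hkt
    filter_upwards [hkt.eventually P.ψ_κ, hst2.eventually hσtS,
      (continuousAt_fst (p := ((e₀, 0) : W × ℝ))).eventually P.ψ_mem] with p h1 h2 h3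
    exact h1 (P.comp_mem _ h3 _ h2.2 h2.1.symm)
  have hkS' : ∀ᶠ e in 𝓝 e₀, ∀ᶠ θ in 𝓝 (0 : ℝ), P.ψ (P.κ (k (e, θ))) = k (e, θ) :=
    Filter.Eventually.curry (by rwa [nhds_prod_eq] at hkS)
  have key : ∀ᶠ e in 𝓝 e₀, ∀ (c : ℝ → W) (τ : ℝ), c τ = e → HasDerivAt c (V e) τ →
      HasVelocityAt I (fun θ ↦ P.ψ (c θ)) (α.leftExtension (P.ψ e) : E) τ := by
    filter_upwards [hkS', hst.eventually hσf, P.κ_ψ,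
      hinr.eventually (hm.eventually (by simp)),
      (contMDiffAt_iff_contMDiffAt_nhds (by simp)).1 P.smooth_ψ] with e h1 h2 h3 h4 h5 c τ hc hcV
    obtain ⟨A, hA⟩ : ∃ A : W →L[ℝ] E, HasMFDerivAt 𝓘(ℝ, W) I P.ψ e A :=
      ⟨_, (h5.mdifferentiableAt (by simp)).hasMFDerivAt⟩
    have hke : k (e, 0) = P.ψ e := by
      change 𝒞.comp (P.ψ e) (σ (𝒞.s (P.ψ e)) 0) = _
      rw [h2.zero, 𝒞.comp_unit]
    have v1 : HasVelocityAt I (fun θ ↦ k (e, θ)) (α.leftExtension (P.ψ e) : E) 0 :=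
      h2.hasVelocityAt_comp
    have hline : HasDerivAt (fun θ : ℝ ↦ (e, θ)) ((0 : W), (1 : ℝ)) 0 :=
      (hasDerivAt_const 0 e).prodMk (hasDerivAt_id 0)
    have d2 : HasDerivAt (fun θ ↦ P.κ (k (e, θ))) (V e) 0 :=
      ((h4.differentiableAt (by simp)).hasFDerivAt).comp_hasDerivAt (0 : ℝ) hline
    have v2 : HasVelocityAt I (P.ψ ∘ fun θ ↦ P.κ (k (e, θ))) (A (V e)) 0 :=
      HasVelocityAt.map (by rwa [hke, h3]) (hasVelocityAt_iff_hasDerivAt.2 d2)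
    have hAV : A (V e) = (α.leftExtension (P.ψ e) : E) := v2.unique (v1.congr_of_eventuallyEq h1)
    rw [← hAV]
    exact HasVelocityAt.map (f := P.ψ) (by rwa [hc]) (hasVelocityAt_iff_hasDerivAt.2 hcV)
  obtain ⟨ε, hε, hflow⟩ := hV.exists_forall_eventually_hasDerivAt_mem key
  have hκu : Filter.Tendsto (fun x ↦ P.κ (𝒞.u x)) (𝓝 x₀) (𝓝 e₀) :=
    P.smooth_κ.continuousAt.tendsto.comp 𝒞.smooth_u.continuous.continuousAt
  refine ⟨ε, hε, ?_⟩
  filter_upwards [hκu.eventually hflow,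
    𝒞.smooth_u.continuous.continuousAt.eventually P.ψ_κ] with y ⟨c, hc0, hc⟩ hy
  refine ⟨fun θ ↦ P.ψ (c θ), by beta_reduce; rw [hc0, hy (P.unit_mem y)], ?_⟩
  rw [isMIntegralCurveOn_iff_hasVelocityWithinAt]
  intro τ hτ
  exact ((hc τ hτ).2 c τ rfl (hc τ hτ).1).hasVelocityWithinAt

end UnitParametrization

end LieCategory.LeftAlgebroidSection

end LieCategories

/-! ### From a linear slice in a chart to a parametrization. -/

section LieCategories

variable {E H F K : Type*} [NormedAddCommGroup E] [NormedSpace ℝ E] [TopologicalSpace H]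
  [NormedAddCommGroup F] [NormedSpace ℝ F] [TopologicalSpace K]
  {I : ModelWithCorners ℝ E H} {J : ModelWithCorners ℝ F K}
  {C : Type*} [TopologicalSpace C] [ChartedSpace H C]
  {X : Type*} [TopologicalSpace X] [ChartedSpace K X]

/-- In the preferred charts, the derivative of a map is its derivative as a manifold map. -/
lemma MDifferentiableAt.hasFDerivWithinAt_extChartAt {f : C → X} {p : C} {x : X}
    (hf : MDifferentiableAt I J f p) (hx : f p = x) :
    HasFDerivWithinAt (fun e ↦ extChartAt J x (f ((extChartAt I p).symm e)))
      (mfderiv I J f p : E →L[ℝ] F) (range I) (extChartAt I p p) := by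
  subst hx
  have h := hf.hasMFDerivAt.2
  exact h

lemma eventually_mem_extChartAt_target (p : C) :
    ∀ᶠ e in 𝓝 (extChartAt I p p), e ∈ range I → e ∈ (extChartAt I p).target :=
  mem_nhdsWithin_iff_eventually.1 (extChartAt_target_mem_nhdsWithin p)

namespace LieCategory.LeftAlgebroidSection

variable [IsManifold I ∞ C] {𝒞 : LieCategory I J C X}

/-- In the preferred chart at the unit at `x₀`, the subcategory `S` is the trace of the linear
subspace `W`, to which the section `α` is tangent, and `t` restricts to a submersion on `S`. -/
structure IsUnitSlice (α : 𝒞.LeftAlgebroidSection) (x₀ : X) (W : Submodule ℝ E) (S : Set C) :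
    Prop where
  unit_mem : ∀ x, 𝒞.u x ∈ S
  comp_mem : ∀ g ∈ S, ∀ h ∈ S, 𝒞.s g = 𝒞.t h → 𝒞.comp g h ∈ S
  chart_mem : ∀ᶠ p in 𝓝 (𝒞.u x₀), p ∈ S → extChartAt I (𝒞.u x₀) p ∈ W
  symm_mem : ∀ᶠ e in 𝓝 (extChartAt I (𝒞.u x₀) (𝒞.u x₀)), e ∈ W →
    e ∈ range I ∧ (extChartAt I (𝒞.u x₀)).symm e ∈ S
  velocity_mem : ∀ᶠ x in 𝓝 x₀,
    (mfderiv I 𝓘(ℝ, E) (extChartAt I (𝒞.u x₀)) (𝒞.u x) : E →L[ℝ] E) (α.toFun x) ∈ W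
  surj : ∀ v : F, ∃ w ∈ W, (mfderiv I J 𝒞.t (𝒞.u x₀) : E →L[ℝ] F) w = v

lemma IsUnitSlice.nonempty_unitParametrization [FiniteDimensional ℝ E] [FiniteDimensional ℝ F]
    {α : 𝒞.LeftAlgebroidSection} {x₀ : X} {W : Submodule ℝ E} {S : Set C}
    (h : α.IsUnitSlice x₀ W S) : Nonempty (α.UnitParametrization x₀ W S) := by
  have : IsManifold I 1 C := IsManifold.of_le (n := ∞) (by simp)
  have : IsManifold I 2 C := IsManifold.of_le (n := ∞) two_le_infty
  set φ := extChartAt I (𝒞.u x₀) with hφ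
  -- A linear projection onto the slice turns the chart into `W`-valued coordinates defined on all
  -- of `C`.
  obtain ⟨r, hr⟩ : ∃ r : E →L[ℝ] W, ∀ w : W, r w = w :=
    Submodule.ClosedComplemented.of_finiteDimensional W
  have hr' (e : E) (he : e ∈ W) : (r e : E) = e := congrArg Subtype.val (hr ⟨e, he⟩)
  have hp0 : φ (𝒞.u x₀) ∈ W := h.chart_mem.self_of_nhds (h.unit_mem x₀)
  have hval : Filter.Tendsto (Subtype.val : W → E) (𝓝 (r (φ (𝒞.u x₀)))) (𝓝 (φ (𝒞.u x₀))) := by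
    have := (continuous_subtype_val (p := fun e ↦ e ∈ W)).tendsto (r (φ (𝒞.u x₀)))
    rwa [hr' _ hp0] at this
  have hrange : ∀ᶠ e : W in 𝓝 (r (φ (𝒞.u x₀))), (e : E) ∈ range I :=
    (hval.eventually h.symm_mem).mono fun e he ↦ (he e.2).1
  let L : W →L[ℝ] F := (mfderiv I J 𝒞.t (𝒞.u x₀) : E →L[ℝ] F).comp W.subtypeL
  have hLsurj : Function.Surjective L := fun v ↦ by
    obtain ⟨w, hw, hwv⟩ := h.surj v
    exact ⟨⟨w, hw⟩, hwv⟩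
  obtain ⟨B, hB⟩ := (L : W →ₗ[ℝ] F).exists_rightInverse_of_surjective
    (LinearMap.range_eq_top.2 hLsurj)
  let a : X → W := fun x ↦
    r (trivializationAt E (TangentSpace I) (𝒞.u x₀) ⟨𝒞.u x, α.toFun x⟩).2
  have ha : ∀ᶠ x in 𝓝 x₀, a x =
      r ((mfderiv I 𝓘(ℝ, E) φ (𝒞.u x) : E →L[ℝ] E) (α.toFun x)) := by
    have hu := 𝒞.smooth_u.continuous.continuousAt.eventually
      (chart_source_mem_nhds H (𝒞.u x₀))
    filter_upwards [hu] with x hx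
    have h1 := DFunLike.congr_fun (TangentBundle.continuousLinearMapAt_trivializationAt (I := I) hx)
      (α.toFun x)
    rw [Bundle.Trivialization.continuousLinearMapAt_apply,
      Bundle.Trivialization.coe_linearMapAt_of_mem _
      (by rwa [TangentBundle.trivializationAt_baseSet])] at h1
    exact congrArg r h1
  refine ⟨⟨fun e ↦ φ.symm e, fun p ↦ r (φ p), a, L, B.toContinuousLinearMap,
    h.unit_mem, h.comp_mem, ?_, ?_, ?_, ?_, ?_, ?_, ?_, ?_, ?_⟩⟩
  -- The inverse chart is smooth only within `range I`; its restriction to `W` is smooth outright,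
  -- because `W` lies in `range I` near the point.
  · have h1 : ContMDiffWithinAt 𝓘(ℝ, E) I 2 φ.symm (range I) (φ (𝒞.u x₀)) :=
      (contMDiffOn_extChartAt_symm (n := 2) (𝒞.u x₀) _
        (mem_extChartAt_target (𝒞.u x₀))).mono_of_mem_nhdsWithin
          (extChartAt_target_mem_nhdsWithin _)
    have h2 : ContMDiffAt 𝓘(ℝ, W) 𝓘(ℝ, E) 2 (Subtype.val : W → E) (r (φ (𝒞.u x₀))) :=
      W.subtypeL.contDiff.contMDiff.contMDiffAt
    exact (h1.comp_of_eq (s := Subtype.val ⁻¹' range I) h2.contMDiffWithinAt (fun _ h ↦ h)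
      (hr' _ hp0)).contMDiffAt hrange
  · exact r.contDiff.contMDiff.contMDiffAt.comp _ contMDiffAt_extChartAt
  · exact r.contDiff.contMDiff.contMDiffAt.comp x₀
      ((Bundle.contMDiffAt_totalSpace.1 (α.smooth.contMDiffAt.of_le two_le_infty)).2)
  · exact (hval.eventually h.symm_mem).mono fun e he ↦ (he e.2).2
  · filter_upwards [hrange, hval.eventually (eventually_mem_extChartAt_target _)] with e h1 h2
    rw [φ.right_inv (h2 h1), hr]
  · filter_upwards [h.chart_mem, extChartAt_source_mem_nhds (I := I) (𝒞.u x₀)] with p h1 h2 hpS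
    rw [hr' _ (h1 hpS), φ.left_inv h2]
  · have h1 := (𝒞.mdifferentiable_t (𝒞.u x₀)).hasFDerivWithinAt_extChartAt (𝒞.t_unit x₀)
    rw [← hr' _ hp0] at h1
    exact (h1.comp (s := Subtype.val ⁻¹' range I) _
      W.subtypeL.hasFDerivAt.hasFDerivWithinAt (fun _ h ↦ h)).hasFDerivAt hrange
  · exact fun y ↦ DFunLike.congr_fun hB y
  · have hφu : Filter.Tendsto (fun x ↦ φ (𝒞.u x)) (𝓝 x₀) (𝓝 (φ (𝒞.u x₀))) :=
      (continuousAt_extChartAt (𝒞.u x₀)).tendsto.comp 𝒞.smooth_u.continuous.continuousAt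
    filter_upwards [ha, h.velocity_mem, hφu.eventually h.symm_mem.eventually_nhds,
      𝒞.smooth_u.continuous.continuousAt.eventually h.chart_mem,
      𝒞.smooth_u.continuous.continuousAt.eventually
        (extChartAt_source_mem_nhds (I := I) (𝒞.u x₀))]
      with x h1 h2 h3 h4 h5 c hc0 hc
    have hcx : (c 0 : E) = φ (𝒞.u x) := by rw [hc0, hr' _ (h4 (h.unit_mem x))]
    have hcd : HasDerivAt (fun θ ↦ (c θ : E)) (a x : E) 0 :=
      W.subtypeL.hasFDerivAt.comp_hasDerivAt 0 hc
    refine hasVelocityAt_extChartAt_symm h5 hcx hcd ?_ ?_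
    · have := hcd.continuousAt.tendsto
      rw [hcx] at this
      exact (this.eventually h3).mono fun θ hθ ↦ (hθ (c θ).2).1
    · rw [h1, hr' _ h2]

end LieCategory.LeftAlgebroidSection

end LieCategories

/-! ### Tangent cones of fibres in a half-space. -/

section HalfSpace

variable {E F : Type*} [NormedAddCommGroup E] [NormedSpace ℝ E] [NormedAddCommGroup F]
  [NormedSpace ℝ F]

lemma frontier_setOf_zero_le {φ : E →L[ℝ] ℝ} (hφ : φ ≠ 0) : frontier {v | 0 ≤ φ v} = {v | φ v = 0} := by
  have h := (φ.isOpenMap_of_ne_zero hφ).preimage_frontier_eq_frontier_preimage φ.continuous (Ici 0)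
  rw [frontier_Ici] at h
  exact h.symm

/-- At a boundary point of a half-space at which `G` restricts to a submersion of the bounding
hyperplane, an inward pointing vector in the kernel of the derivative of `G` is tangent to the
fibre of `G`. -/
lemma mem_tangentConeAt_fibre_inter_halfSpace [CompleteSpace F] {φ : E →L[ℝ] ℝ} {p : E}
    (hp : φ p = 0) {G : E → F} (hG : ContDiffWithinAt ℝ 1 G {v | 0 ≤ φ v} p) {L : E →L[ℝ] F}
    (hL : HasFDerivWithinAt G L {v | 0 ≤ φ v} p) {B : F →L[ℝ] E} (hLB : ∀ y, L (B y) = y)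
    (hφB : ∀ y, φ (B y) = 0) {w : E} (hLw : L w = 0) (hφw : 0 < φ w) :
    w ∈ tangentConeAt ℝ ({e | G e = G p} ∩ {v | 0 ≤ φ v}) p := by
  -- The square keeps `ι` in the half-space for both signs of the parameter, so the inverse function
  -- theorem applies on a full neighbourhood of `(0, 0)`.
  let ι : ℝ × F → E := fun z ↦ p + (z.1 ^ 2 • w + B z.2)
  have hι0 : ι (0, 0) = p := by simp [ι]
  have hιD (z) : ι z ∈ {v | 0 ≤ φ v} := by
    have : φ (ι z) = z.1 ^ 2 * φ w := by simp [ι, hp, hφB]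
    rw [mem_ofPred_eq, this]
    positivity
  have hι : ContDiff ℝ 1 ι := by fun_prop
  have hι' : HasFDerivAt ι (B.comp (ContinuousLinearMap.snd ℝ ℝ F)) (0, 0) := by
    have h1 : HasFDerivAt (fun z : ℝ × F ↦ z.1 ^ 2 • w)
        ((0 : ℝ × F →L[ℝ] ℝ).smulRight w) (0, 0) := by
      have h2 : HasFDerivAt (fun z : ℝ × F ↦ z.1 ^ 2) (0 : ℝ × F →L[ℝ] ℝ) (0, 0) := by
        have h3 := (ContinuousLinearMap.fst ℝ ℝ F).hasFDerivAt (x := ((0 : ℝ), (0 : F))) |>.pow 2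
        exact h3.congr_fderiv (by ext <;> simp)
      exact h2.smul_const w
    have h2 := (h1.add (B.comp (ContinuousLinearMap.snd ℝ ℝ F)).hasFDerivAt).const_add p
    exact h2.congr_fderiv (by ext <;> simp)
  have hg : ContDiffAt ℝ 1 (fun z ↦ G (ι z)) (0, 0) := by
    rw [← contDiffWithinAt_univ]
    rw [← hι0] at hG
    exact hG.comp (0, 0) hι.contDiffWithinAt fun z _ ↦ hιD z
  have hg' : HasFDerivAt (fun z ↦ G (ι z)) (ContinuousLinearMap.snd ℝ ℝ F) (0, 0) := by
    rw [← hasFDerivWithinAt_univ]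
    rw [← hι0] at hL
    have h1 := hL.comp (0, 0) hι'.hasFDerivWithinAt (fun z (_ : z ∈ univ) ↦ hιD z)
    exact h1.congr_fderiv (by ext <;> simp [hLB])
  have hΘ : HasStrictFDerivAt (fun z ↦ (z.1, G (ι z)))
      ((ContinuousLinearEquiv.refl ℝ (ℝ × F) : (ℝ × F) ≃L[ℝ] ℝ × F) : ℝ × F →L[ℝ] ℝ × F)
      (0, 0) :=
    (ContinuousLinearMap.fst ℝ ℝ F).hasStrictFDerivAt.prodMk
      (hg.hasStrictFDerivAt' hg' (by simp))
  let inv := hΘ.localInverse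
  have hinv0 : inv (0, G p) = (0, 0) := by
    have := hΘ.localInverse_apply_image
    rwa [hι0] at this
  have hinvc : ContinuousAt inv (0, G p) := by
    have := hΘ.localInverse_continuousAt
    rwa [hι0] at this
  have hinvr : ∀ᶠ z in 𝓝 ((0 : ℝ), G p), ((inv z).1, G (ι (inv z))) = z := by
    have := hΘ.eventually_right_inverse
    rwa [hι0] at this
  have hcurve : Filter.Tendsto (fun ε : ℝ ↦ (ε, G p)) (𝓝[≠] 0) (𝓝 (0, G p)) :=
    (Continuous.tendsto (by fun_prop) 0).mono_left nhdsWithin_le_nhds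
  let y : ℝ → F := fun ε ↦ (inv (ε, G p)).2
  let δ : ℝ → E := fun ε ↦ ε ^ 2 • w + B (y ε)
  have hpδ : ∀ᶠ ε in 𝓝[≠] (0 : ℝ), ι (inv (ε, G p)) = p + δ ε ∧ G (p + δ ε) = G p := by
    filter_upwards [hcurve.eventually hinvr] with ε hε
    have h1 : (inv (ε, G p)).1 = ε := congrArg Prod.fst hε
    have h2 : ι (inv (ε, G p)) = p + δ ε := by simp only [ι, δ, y, h1]
    exact ⟨h2, h2 ▸ congrArg Prod.snd hε⟩
  have hy0 : Filter.Tendsto y (𝓝[≠] 0) (𝓝 0) := by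
    have := (hinvc.tendsto.comp hcurve).snd_nhds
    rwa [hinv0] at this
  have hδ0 : Filter.Tendsto δ (𝓝[≠] 0) (𝓝 0) := by
    have h1 : Filter.Tendsto (fun ε : ℝ ↦ ε ^ 2 • w) (𝓝[≠] 0) (𝓝 0) := by
      refine Filter.Tendsto.mono_left ?_ nhdsWithin_le_nhds
      exact Continuous.tendsto' (by fun_prop) _ _ (by simp)
    have h2 : Filter.Tendsto (fun ε : ℝ ↦ B (y ε)) (𝓝[≠] 0) (𝓝 0) := by
      have := (B.continuous.tendsto 0).comp hy0
      rwa [map_zero] at this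
    simpa using h1.add h2
  have hmem : ∀ᶠ ε in 𝓝[≠] (0 : ℝ), p + δ ε ∈ {e | G e = G p} ∩ {v | 0 ≤ φ v} :=
    hpδ.mono fun ε hε ↦ ⟨hε.2, hε.1 ▸ hιD _⟩
  -- Since `G (p + δ) = G p` and `L δ = y`, the first-order expansion of `G` says exactly that `y =
  -- o(δ)`. Hence `δ` is equivalent to `ε² w`, and `δ / ε²` tends to `w`.
  have hyδ : y =o[𝓝[≠] 0] δ := by
    have h1 := hasFDerivWithinAt_iff_isLittleO.1 hL
    have h2 : Filter.Tendsto (fun ε ↦ p + δ ε) (𝓝[≠] 0) (𝓝[{v | 0 ≤ φ v}] p) := by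
      refine tendsto_nhdsWithin_iff.2 ⟨?_, hmem.mono fun ε hε ↦ hε.2⟩
      simpa using hδ0.const_add p
    have h3 := (h1.comp_tendsto h2).neg_left
    refine h3.congr' ?_ ?_
    · filter_upwards [hpδ] with ε hε
      simp [hε.2, δ, hLw, hLB]
    · exact Filter.Eventually.of_forall fun ε ↦ by simp
  have hBδ : (fun ε ↦ δ ε - ε ^ 2 • w) =o[𝓝[≠] 0] fun ε : ℝ ↦ ε ^ 2 • w := by
    have h1 : (fun ε ↦ B (y ε)) =o[𝓝[≠] 0] δ := (B.isBigO_comp y _).trans_isLittleO hyδ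
    have h2 : Asymptotics.IsEquivalent (𝓝[≠] 0) (fun ε : ℝ ↦ ε ^ 2 • w) δ := by
      refine h1.neg_left.congr_left fun ε ↦ ?_
      simp [δ]
    exact h2.symm
  refine mem_tangentConeAt_of_seq (𝓝[≠] (0 : ℝ)) (fun ε ↦ (ε ^ 2)⁻¹) δ hδ0 hmem ?_
  have h1 : (fun ε : ℝ ↦ (ε ^ 2)⁻¹ • (δ ε - ε ^ 2 • w)) =o[𝓝[≠] 0]
      fun ε : ℝ ↦ (ε ^ 2)⁻¹ • (ε ^ 2 • w) :=
    (Asymptotics.isBigO_refl (fun ε : ℝ ↦ (ε ^ 2)⁻¹) _).smul_isLittleO hBδ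
  have h2 : (fun ε : ℝ ↦ (ε ^ 2)⁻¹ • (δ ε - ε ^ 2 • w)) =o[𝓝[≠] 0] fun _ : ℝ ↦ w := by
    refine h1.congr' Filter.EventuallyEq.rfl ?_
    filter_upwards [self_mem_nhdsWithin] with ε hε
    rw [smul_smul, inv_mul_cancel₀ (pow_ne_zero 2 hε), one_smul]
  have hw : w ≠ 0 := fun h ↦ by simp [h] at hφw
  have h3 := ((Asymptotics.isLittleO_const_iff hw).1 h2).add_const w
  rw [zero_add] at h3
  refine h3.congr' ?_
  filter_upwards [self_mem_nhdsWithin] with ε hε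
  rw [smul_sub, smul_smul, inv_mul_cancel₀ (pow_ne_zero 2 hε), one_smul, sub_add_cancel]

end HalfSpace

/-! ### Slices at interior and boundary units, and tangency of `α` to the boundary. -/

section LieCategories

variable {E H F K : Type*} [NormedAddCommGroup E] [NormedSpace ℝ E] [TopologicalSpace H]
  [NormedAddCommGroup F] [NormedSpace ℝ F] [TopologicalSpace K]
  {I : ModelWithCorners ℝ E H} {J : ModelWithCorners ℝ F K}
  {C : Type*} [TopologicalSpace C] [ChartedSpace H C]
  {X : Type*} [TopologicalSpace X] [ChartedSpace K X]

/-- Boundary points can be recognized in every preferred chart. -/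
lemma mem_boundary_iff_extChartAt_mem_frontier [IsManifold I ∞ C] {p q : C}
    (hp : p ∈ (extChartAt I q).source) :
    p ∈ I.boundary C ↔ extChartAt I q p ∈ frontier (range I) := by
  rw [extChartAt_source] at hp
  have h1 : p ∈ I.interior C ↔ extChartAt I q p ∈ interior (range I) := by
    refine (I.isInteriorPoint_iff_of_mem_atlas (n := ∞) (by simp) (chart_mem_atlas H q) hp).trans
      ⟨fun h ↦ (chartAt H q).interior_extend_target_subset_interior_range h, fun h ↦ ?_⟩
    exact (chartAt H q).mem_interior_extend_target ((chartAt H q).map_source hp) h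
  have h2 : extChartAt I q p ∈ range I := mem_range_self _
  rw [← ModelWithCorners.compl_interior, mem_compl_iff, h1, mem_interior_iff_notMem_frontier h2,
    not_not]

lemma boundaryTangentSpace_le_ker {φ : E →L[ℝ] ℝ} (hφ : range I = {v | 0 ≤ φ v}) (hφ0 : φ ≠ 0)
    {g : C} {v : E} (hv : v ∈ (boundaryTangentSpace I g : Submodule ℝ E)) : φ v = 0 := by
  have h : vectorSpan ℝ (frontier (range I)) ≤ φ.ker := by
    rw [hφ, frontier_setOf_zero_le hφ0]
    refine Submodule.span_le.2 ?_
    rintro _ ⟨a, ha, b, hb, rfl⟩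
    rw [mem_ofPred_eq] at ha hb
    simp [ha, hb]
  exact h hv

namespace LieCategory

variable {𝒞 : LieCategory I J C X}

/-- The derivative of the left translation by a unit, which is the identity of the `t`-fibre, is
determined on the tangent cone of the fibre. -/
lemma leftDeriv_unit_eq {x : X} {w : E} (hw : w ∈ tangentConeAt ℝ
      ((extChartAt I (𝒞.u x)).symm ⁻¹' (𝒞.t ⁻¹' {x}) ∩ range I)
      (extChartAt I (𝒞.u x) (𝒞.u x))) :
    𝒞.leftDeriv (𝒞.u x) (𝒞.u x) w = w := by
  have h1 := 𝒞.hasMFDerivWithinAt_comp (g := 𝒞.u x) (h := 𝒞.u x) (by rw [𝒞.s_unit, 𝒞.t_unit])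
  rw [𝒞.s_unit] at h1
  have hid (g : C) (hg : g ∈ 𝒞.t ⁻¹' {x}) : g = 𝒞.comp (𝒞.u x) g := by
    rw [mem_preimage, mem_singleton_iff] at hg
    rw [← hg, 𝒞.unit_comp]
  have h2 : HasMFDerivWithinAt I I (fun g ↦ g) (𝒞.t ⁻¹' {x}) (𝒞.u x)
      (𝒞.leftDeriv (𝒞.u x) (𝒞.u x)) :=
    h1.congr_mono hid (hid _ (𝒞.t_unit x)) subset_rfl
  have h3 : HasMFDerivWithinAt I I (fun g : C ↦ g) (𝒞.t ⁻¹' {x}) (𝒞.u x)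
      (ContinuousLinearMap.id ℝ E) := hasMFDerivWithinAt_id _ _
  have k2 : HasFDerivWithinAt (writtenInExtChartAt I I (𝒞.u x) fun g ↦ g)
      (𝒞.leftDeriv (𝒞.u x) (𝒞.u x))
      ((extChartAt I (𝒞.u x)).symm ⁻¹' (𝒞.t ⁻¹' {x}) ∩ range I)
      (extChartAt I (𝒞.u x) (𝒞.u x)) := h2.2
  have k3 : HasFDerivWithinAt (writtenInExtChartAt I I (𝒞.u x) fun g ↦ g)
      (ContinuousLinearMap.id ℝ E)
      ((extChartAt I (𝒞.u x)).symm ⁻¹' (𝒞.t ⁻¹' {x}) ∩ range I)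
      (extChartAt I (𝒞.u x) (𝒞.u x)) := h3.2
  exact k2.unique_on k3 hw

end LieCategory

namespace LieCategory.LeftAlgebroidSection

variable [IsManifold I ∞ C] {𝒞 : LieCategory I J C X} {α : 𝒞.LeftAlgebroidSection}

lemma isUnitSlice_univ (hunits : range 𝒞.u ⊆ I.interior C) (x₀ : X) :
    α.IsUnitSlice x₀ ⊤ univ where
  unit_mem _ := mem_univ _
  comp_mem _ _ _ _ _ := mem_univ _
  chart_mem := Filter.Eventually.of_forall fun _ _ ↦ Submodule.mem_top
  symm_mem := by
    have : range I ∈ 𝓝 (extChartAt I (𝒞.u x₀) (𝒞.u x₀)) :=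
      range_mem_nhds_isInteriorPoint (hunits (mem_range_self x₀))
    exact Filter.Eventually.mono this fun e he _ ↦ ⟨he, mem_univ _⟩
  velocity_mem := Filter.Eventually.of_forall fun _ ↦ trivial
  surj v := by
    obtain ⟨w, hw⟩ := 𝒞.submersion_t (𝒞.u x₀) v
    exact ⟨w, Submodule.mem_top, hw⟩

lemma leftExtension_unit (α : 𝒞.LeftAlgebroidSection) (x : X) :
    (α.leftExtension (𝒞.u x) : E) = 𝒞.leftDeriv (𝒞.u x) (𝒞.u x) (α.toFun x : E) := by
  have h (y : X) (hy : y = x) : 𝒞.leftDeriv (𝒞.u x) (𝒞.u y) (α.toFun y : E) =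
      𝒞.leftDeriv (𝒞.u x) (𝒞.u x) (α.toFun x : E) := by subst hy; rfl
  exact h _ (𝒞.s_unit x)

variable [FiniteDimensional ℝ F]

/-- A vector in `ker dt` that points inwards at a boundary unit is tangent to the `t`-fibre. -/
lemma mem_tangentConeAt_fibre {φ : E →L[ℝ] ℝ} (hφ : range I = {v | 0 ≤ φ v}) {x : X}
    (hx : φ (extChartAt I (𝒞.u x) (𝒞.u x)) = 0)
    (hsurj : ∀ v : F, ∃ w ∈ φ.ker, (mfderiv I J 𝒞.t (𝒞.u x) : E →L[ℝ] F) w = v) {w : E}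
    (hw : (mfderiv I J 𝒞.t (𝒞.u x) : E →L[ℝ] F) w = 0) (hφw : 0 < φ w) :
    w ∈ tangentConeAt ℝ ((extChartAt I (𝒞.u x)).symm ⁻¹' (𝒞.t ⁻¹' {x}) ∩ range I)
      (extChartAt I (𝒞.u x) (𝒞.u x)) := by
  have : CompleteSpace F := FiniteDimensional.complete ℝ F
  have hp : extChartAt J x (𝒞.t ((extChartAt I (𝒞.u x)).symm (extChartAt I (𝒞.u x) (𝒞.u x)))) =
      extChartAt J x x := by rw [extChartAt_to_inv, 𝒞.t_unit]
  have hsymm : ContMDiffWithinAt 𝓘(ℝ, E) I 1 (extChartAt I (𝒞.u x)).symm (range I)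
      (extChartAt I (𝒞.u x) (𝒞.u x)) :=
    (contMDiffOn_extChartAt_symm (n := 1) (𝒞.u x) _
      (mem_extChartAt_target (𝒞.u x))).mono_of_mem_nhdsWithin (extChartAt_target_mem_nhdsWithin _)
  have ht : ContMDiffWithinAt 𝓘(ℝ, E) J 1 (fun e ↦ 𝒞.t ((extChartAt I (𝒞.u x)).symm e)) (range I)
      (extChartAt I (𝒞.u x) (𝒞.u x)) :=
    (𝒞.smooth_t.contMDiffAt.of_le (by simp)).comp_contMDiffWithinAt _ hsymm
  have hG : ContMDiffWithinAt 𝓘(ℝ, E) 𝓘(ℝ, F) 1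
      (fun e ↦ extChartAt J x (𝒞.t ((extChartAt I (𝒞.u x)).symm e))) (range I)
      (extChartAt I (𝒞.u x) (𝒞.u x)) :=
    (contMDiffAt_extChartAt (x := x)).comp_contMDiffWithinAt_of_eq ht
      (by rw [extChartAt_to_inv, 𝒞.t_unit])
  have hL := (𝒞.mdifferentiable_t (𝒞.u x)).hasFDerivWithinAt_extChartAt (𝒞.t_unit x)
  let L : φ.ker →L[ℝ] F := (mfderiv I J 𝒞.t (𝒞.u x) : E →L[ℝ] F).comp φ.ker.subtypeL
  have hLsurj : Function.Surjective L := fun v ↦ by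
    obtain ⟨w, hw, hwv⟩ := hsurj v
    exact ⟨⟨w, hw⟩, hwv⟩
  obtain ⟨B, hB⟩ := (L : φ.ker →ₗ[ℝ] F).exists_rightInverse_of_surjective
    (LinearMap.range_eq_top.2 hLsurj)
  have hmem := mem_tangentConeAt_fibre_inter_halfSpace hx
    (hφ ▸ contMDiffWithinAt_iff_contDiffWithinAt.1 hG) (hφ ▸ hL)
    (B := φ.ker.subtypeL.comp B.toContinuousLinearMap) (fun y ↦ DFunLike.congr_fun hB y)
    (fun y ↦ (B y).2) hw hφw
  -- Near the unit, the fibre of the coordinate expression of `t` is the `t`-fibre, as the base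
  -- chart is injective on its source.
  refine tangentConeAt_mono_nhds ?_ hmem
  rw [← hφ, inter_comm, inter_comm _ (range I), nhdsWithin_inter', nhdsWithin_inter']
  refine le_inf inf_le_left (Filter.le_principal_iff.2 ?_)
  have hsrc := ht.continuousWithinAt.eventually
    (extChartAt_source_mem_nhds' (I := J) (x := x) (by
      beta_reduce
      rw [extChartAt_to_inv, 𝒞.t_unit]
      exact mem_extChartAt_source x))
  filter_upwards [Filter.mem_inf_of_left hsrc, Filter.mem_inf_of_right
    (Filter.mem_principal_self _)] with e h1 h2
  exact (extChartAt J x).injOn h1 (mem_extChartAt_source x) (h2.trans hp)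

/-- If `φ v ≠ 0`, then `v` or `-v` points inwards and so lies in the tangent cone of the fibre.
There the derivative of left translation by the unit is the identity, and `φ v` would vanish after
all. -/
lemma apply_eq_zero_of_apply_leftDeriv_unit {φ : E →L[ℝ] ℝ} (hφ : range I = {v | 0 ≤ φ v}) {x : X}
    (hx : φ (extChartAt I (𝒞.u x) (𝒞.u x)) = 0)
    (hsurj : ∀ v : F, ∃ w ∈ φ.ker, (mfderiv I J 𝒞.t (𝒞.u x) : E →L[ℝ] F) w = v) {v : E}
    (hv : (mfderiv I J 𝒞.t (𝒞.u x) : E →L[ℝ] F) v = 0)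
    (h : φ (𝒞.leftDeriv (𝒞.u x) (𝒞.u x) v) = 0) : φ v = 0 := by
  by_contra hne
  rcases lt_or_gt_of_ne hne with hlt | hgt
  · have h1 : 𝒞.leftDeriv (𝒞.u x) (𝒞.u x) (-v) = -v :=
      leftDeriv_unit_eq (mem_tangentConeAt_fibre hφ hx hsurj
        (((mfderiv I J 𝒞.t (𝒞.u x) : E →L[ℝ] F).map_neg v).trans (by rw [hv, neg_zero]))
        (by rw [map_neg]; linarith))
    rw [map_neg, neg_inj] at h1
    rw [h1] at h
    exact hne h
  · rw [leftDeriv_unit_eq (mem_tangentConeAt_fibre hφ hx hsurj hv hgt)] at h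
    exact hne h

/-- In each preferred chart at a boundary unit, `∂C` is the trace of the hyperplane `ker φ`, which
therefore serves as the slice. -/
lemma isUnitSlice_boundary {φ : E →L[ℝ] ℝ} (hφ : range I = {v | 0 ≤ φ v})
    (hunits : range 𝒞.u ⊆ I.boundary C)
    (hcomp : ∀ g ∈ I.boundary C, ∀ h ∈ I.boundary C, 𝒞.s g = 𝒞.t h → 𝒞.comp g h ∈ I.boundary C)
    (htan : ∀ x, α.leftExtension (𝒞.u x) ∈ boundaryTangentSpace I (𝒞.u x)) (x₀ : X) :
    α.IsUnitSlice x₀ φ.ker (I.boundary C) := by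
  have : IsManifold I 1 C := IsManifold.of_le (n := ∞) (by simp)
  have hu (x : X) : 𝒞.u x ∈ I.boundary C := hunits (mem_range_self x)
  -- For `φ = 0` the model is the whole space and its frontier is empty, which excludes boundary
  -- units.
  have hφ0 : φ ≠ 0 := by
    rintro rfl
    have h1 := (mem_boundary_iff_extChartAt_mem_frontier (mem_extChartAt_source (𝒞.u x₀))).1 (hu x₀)
    rw [hφ] at h1
    simp at h1
  have hfr : frontier (range I) = {v | φ v = 0} := by rw [hφ, frontier_setOf_zero_le hφ0]
  have hbd {p q : C} (hp : p ∈ (extChartAt I q).source) :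
      p ∈ I.boundary C ↔ φ (extChartAt I q p) = 0 := by
    rw [mem_boundary_iff_extChartAt_mem_frontier hp, hfr, mem_ofPred_eq]
  have hsurj (x : X) (v : F) : ∃ w ∈ φ.ker, (mfderiv I J 𝒞.t (𝒞.u x) : E →L[ℝ] F) w = v := by
    obtain ⟨w, hw, hwv⟩ := 𝒞.submersion_boundary_t (𝒞.u x) (hu x) (mem_univ v)
    exact ⟨w, boundaryTangentSpace_le_ker hφ hφ0 hw, hwv⟩
  have hα (x : X) : φ (α.toFun x : E) = 0 :=
    apply_eq_zero_of_apply_leftDeriv_unit hφ ((hbd (mem_extChartAt_source _)).1 (hu x)) (hsurj x)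
      (α.mem_ker x)
      ((congrArg φ (α.leftExtension_unit x)).symm.trans
        (boundaryTangentSpace_le_ker hφ hφ0 (htan x)))
  have hsymm (p : C) : ∀ᶠ e in 𝓝 (extChartAt I p p), e ∈ φ.ker →
      e ∈ range I ∧ (extChartAt I p).symm e ∈ I.boundary C := by
    filter_upwards [eventually_mem_extChartAt_target (I := I) p] with e he hek
    have hek' : φ e = 0 := hek
    have heI : e ∈ range I := by rw [hφ, mem_ofPred_eq, hek']
    refine ⟨heI, (hbd ((extChartAt I p).map_target (he heI))).2 ?_⟩
    rw [(extChartAt I p).right_inv (he heI), hek']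
  refine ⟨hu, hcomp, ?_, hsymm _, ?_, hsurj x₀⟩
  · filter_upwards [extChartAt_source_mem_nhds (I := I) (𝒞.u x₀)] with p hp hpb
    exact (hbd hp).1 hpb
  · filter_upwards [𝒞.smooth_u.continuous.continuousAt.eventually
      (extChartAt_source_mem_nhds (I := I) (𝒞.u x₀))] with x hx
    suffices key : ∀ v : E, φ v = 0 →
        φ ((mfderiv I 𝓘(ℝ, E) (extChartAt I (𝒞.u x₀)) (𝒞.u x) : E →L[ℝ] E) v) = 0 from
      key (α.toFun x) (hα x)
    intro v hv
    -- A line in `ker φ` is a curve in `∂C`. In the chart at `u x₀` it again runs in `ker φ`, and so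
    -- does its velocity: changes of chart preserve tangency to the boundary.
    let c : ℝ → E := fun θ ↦ extChartAt I (𝒞.u x) (𝒞.u x) + θ • v
    have hc0 : c 0 = extChartAt I (𝒞.u x) (𝒞.u x) := by simp [c]
    have hc : HasDerivAt c v 0 := by
      have h1 := ((hasDerivAt_id (0 : ℝ)).smul_const v).const_add (extChartAt I (𝒞.u x) (𝒞.u x))
      rwa [one_smul] at h1
    have hck (θ : ℝ) : c θ ∈ φ.ker := by
      have h1 : φ (extChartAt I (𝒞.u x) (𝒞.u x)) = 0 := (hbd (mem_extChartAt_source _)).1 (hu x)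
      change φ (c θ) = 0
      rw [map_add, map_smul, h1, hv, smul_zero, add_zero]
    have hct : ∀ᶠ θ in 𝓝 0, c θ ∈ range I ∧ (extChartAt I (𝒞.u x)).symm (c θ) ∈ I.boundary C := by
      have h1 := hc.continuousAt.tendsto
      rw [hc0] at h1
      exact (h1.eventually (hsymm (𝒞.u x))).mono fun θ hθ ↦ hθ (hck θ)
    have v1 : HasVelocityAt I (fun θ ↦ (extChartAt I (𝒞.u x)).symm (c θ)) v 0 :=
      hasVelocityAt_extChartAt_symm (mem_extChartAt_source _) hc0 hc (hct.mono fun _ h ↦ h.1)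
        (by rw [mfderiv_extChartAt_self]; rfl)
    have hk0 : (extChartAt I (𝒞.u x)).symm (c 0) = 𝒞.u x := by
      rw [hc0, extChartAt_to_inv]
    have v2 := v1.map_mfderiv (J := 𝓘(ℝ, E)) (f := extChartAt I (𝒞.u x₀)) (by
      rw [hk0]
      exact mdifferentiableAt_extChartAt (by rwa [extChartAt_source] at hx))
    rw [hk0] at v2
    have d3 := φ.hasFDerivAt.comp_hasDerivAt 0 (hasVelocityAt_iff_hasDerivAt.1 v2)
    refine d3.unique ((hasDerivAt_const (0 : ℝ) (0 : ℝ)).congr_of_eventuallyEq ?_)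
    have hsrc : ∀ᶠ θ in 𝓝 (0 : ℝ), (extChartAt I (𝒞.u x)).symm (c θ) ∈
        (extChartAt I (𝒞.u x₀)).source := by
      refine v1.continuousAt.eventually ((isOpen_extChartAt_source _).mem_nhds ?_)
      change (extChartAt I (𝒞.u x)).symm (c 0) ∈ _
      rwa [hk0]
    filter_upwards [hct, hsrc] with θ h1 h2
    exact (hbd h2).1 h1.2

lemma exists_isUnitSlice (hI : IsHalfSpaceModel I) (hnormal : 𝒞.HasNormalBoundary)
    (hunits : range 𝒞.u ⊆ I.interior C ∨
      (range 𝒞.u ⊆ I.boundary C ∧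
        ∀ x : X, α.leftExtension (𝒞.u x) ∈ boundaryTangentSpace I (𝒞.u x))) (x₀ : X) :
    ∃ (W : Submodule ℝ E) (S : Set C), α.IsUnitSlice x₀ W S := by
  rcases hunits with hunits | ⟨hunits, htan⟩
  · exact ⟨⊤, univ, isUnitSlice_univ hunits x₀⟩
  · obtain ⟨φ, hφ⟩ := hI
    rcases hnormal with hint | ⟨-, hcomp⟩
    · exact absurd (hunits (mem_range_self x₀))
        (disjoint_left.1 ModelWithCorners.disjoint_interior_boundary (hint (mem_range_self x₀)))
    · exact ⟨φ.ker, I.boundary C, isUnitSlice_boundary hφ hunits hcomp htan x₀⟩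

end LieCategory.LeftAlgebroidSection

end LieCategories

/-! ### Assembly of the equivalence. -/

theorem mainTheorem4
    {E H F K : Type*}
    [NormedAddCommGroup E] [NormedSpace ℝ E] [FiniteDimensional ℝ E] [TopologicalSpace H]
    [NormedAddCommGroup F] [NormedSpace ℝ F] [FiniteDimensional ℝ F] [TopologicalSpace K]
    (I : ModelWithCorners ℝ E H) (hI : IsHalfSpaceModel I)
    (J : ModelWithCorners ℝ F K) [J.Boundaryless]
    (C : Type*) [TopologicalSpace C] [ChartedSpace H C] [IsManifold I ∞ C]
    [T2Space C]
    (X : Type*) [TopologicalSpace X] [ChartedSpace K X] [IsManifold J ∞ X]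
    [T2Space X]
    (𝒞 : LieCategory I J C X) (hnormal : 𝒞.HasNormalBoundary)
    (α : 𝒞.LeftAlgebroidSection)
    (hunits : range 𝒞.u ⊆ I.interior C ∨
      (range 𝒞.u ⊆ I.boundary C ∧
        ∀ x : X, α.leftExtension (𝒞.u x) ∈ boundaryTangentSpace I (𝒞.u x))) :
    IsCompleteVectorField I α.leftExtension ↔ IsCompleteVectorField J α.anchor := by
  have hparam (x₀ : X) : ∃ (W : Submodule ℝ E) (S : Set C),
      Nonempty (α.UnitParametrization x₀ W S) := by
    obtain ⟨W, S, h⟩ :=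
      LieCategory.LeftAlgebroidSection.exists_isUnitSlice hI hnormal hunits x₀
    exact ⟨W, S, h.nonempty_unitParametrization⟩
  have hα (x : X) : ∃ σ, α.IsFibreCurve x σ := by
    obtain ⟨W, S, ⟨P⟩⟩ := hparam x
    have : CompleteSpace W := FiniteDimensional.complete ℝ W
    obtain ⟨σ, -, -, h⟩ := P.exists_fibreCurves
    exact ⟨σ x, h.self_of_nhds⟩
  refine ⟨LieCategory.LeftAlgebroidSection.isCompleteVectorField_anchor hα,
    LieCategory.LeftAlgebroidSection.isCompleteVectorField_leftExtension hα fun x₀ ↦ ?_⟩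
  obtain ⟨W, S, ⟨P⟩⟩ := hparam x₀
  have : CompleteSpace W := FiniteDimensional.complete ℝ W
  exact P.exists_flow
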